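/- **Proposition 2.6.** Let $R$ be a commutative noetherian ring, let $\mathfrak n$ be a prime ideal of $R$ that is not a minimal prime, and let $x\in R$ be an element with $\{r\in R\mid rx=0\}=(x)$; in particular $x^2=0$. Let $E=E_R(R/\mathfrak n)$ be the injective hull of the $R$-module $R/\mathfrak n$, and let $J$ be the complex of $R$-modules $$J=\quad\cdots\to 0\to E\xrightarrow{\ x\ }E\xrightarrow{\ x\ }E\xrightarrow{\ x\ }\cdots$$ with the first $E$ in degree $0$. Put $M=\mathrm H^0(J)=\operatorname{Ker}(E\xrightarrow{x}E)$, viewed as a complex concentrated in degree $0$, and let $\iota\colon M\to J$ be the inclusion. Let $\Sigma^i$ denote the $i$-th suspension, $(\Sigma^iY)^n=Y^{n+i}$, and set $$X=\prod_{i\in\mathbb Z}\Sigma^iM,\qquad I=\prod_{i\in\mathbb Z}\Sigma^iJ .$$ Conventions: a complex $Y$ over a commutative ring $S$ is *homotopically injective* if $\operatorname{Hom}_S(-,Y)$ preserves quasi-isomorphisms, and *semi-injective* if moreover each $Y^n$ is an injective $S$-module; $Y$ is *minimal* if $\operatorname{Ker}(\partial^n)\subseteq Y^n$ is an essential extension for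 each $n$; $Y$ is *contractible* if its identity map is null-homotopic. For a complex $Y$ of $R$-modules, $\operatorname{supp}Y=\{\mathfrak p\in\operatorname{Spec}R\mid \mathrm H(Y\otimes^{\mathbf L}_Rk(\mathfrak p))\neq0\}$, where $k(\mathfrak p)=R_{\mathfrak p}/\mathfrak pR_{\mathfrak p}$; and $\operatorname{Ass}N$ is the set of primes that are annihilators of elements of an $R$-module $N$. The following statements hold. 1. The complex $I$ is semi-injective and minimal. 2. The natural map $\prod_{i\in\mathbb Z}\Sigma^i\iota\colon X\to I$ is a quasi-isomorphism. 3. $\operatorname{supp}X=\{\mathfrak n\}$, and $\{\mathfrak n\}\subsetneq\operatorname{Ass}I^k$ for each integer $k$. 4. For any integer $k$ and any prime $\mathfrak p\in\operatorname{Ass}I^k$ with $\mathfrak p\neq\mathfrak n$, the localization $I_{\mathfrak p}$ is a complex of injective $R_{\mathfrak p}$-modules which is acyclic but not contractible, and hence (over $R_{\mathfrak p}$) not homotopically injective. -/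

import Mathlib

open CategoryTheory Limits

universe u

noncomputable section

namespace SupportInjRes

/-! ### Submodules, injective hulls, associated primes -/

/-- `N` is an essential submodule of `M` (that is, `N ⊆ M` is an essential extension):
it meets every nonzero submodule of `M` nontrivially. -/
def IsEssential {R : Type u} [CommRing R] {M : Type u} [AddCommGroup M] [Module R M]
    (N : Submodule R M) : Prop :=
  ∀ L : Submodule R M, L ≠ ⊥ → N ⊓ L ≠ ⊥

/-- The linear map `j : M → E` exhibits `E` as an injective hull of the `R`-module `M`. -/
structure IsInjectiveHull {R : Type u} [CommRing R] {M E : Type u} [AddCommGroup M] [Module R M]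
    [AddCommGroup E] [Module R E] (j : M →ₗ[R] E) : Prop where
  injective_module : Module.Injective R E
  injective_map : Function.Injective j
  essential_range : IsEssential (LinearMap.range j)

/-- `Ass M`, as a subset of `Spec R`. (Over a noetherian ring, Mathlib's `associatedPrimes` are
the primes which are the annihilator of an element, see `isAssociatedPrime_iff`.) -/
def ass (R : Type u) [CommRing R] (M : Type u) [AddCommGroup M] [Module R M] :
    Set (PrimeSpectrum R) :=
  {p | p.asIdeal ∈ associatedPrimes R M}

/-! ### Complexes of modules -/

/-- Complexes of `R`-modules, with cohomological indexing by `ℤ`. -/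
abbrev Cpx (R : Type u) [CommRing R] := CochainComplex (ModuleCat.{u} R) ℤ

/-- The morphism `Hom_R(Y, I) ⟶ Hom_R(X, I)` of Hom complexes induced by `f : X ⟶ Y`. -/
def homPrecomp {R : Type u} [CommRing R] {X Y : Cpx R} (f : X ⟶ Y) (I : Cpx R) :
    CochainComplex.HomComplex Y I ⟶ CochainComplex.HomComplex X I where
  f n := AddCommGrpCat.ofHom
    { toFun := fun z : CochainComplex.HomComplex.Cochain Y I n =>
        (CochainComplex.HomComplex.Cochain.ofHom f).comp z (zero_add n)
      map_zero' := CochainComplex.HomComplex.Cochain.comp_zero _ _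
      map_add' := fun _ _ => CochainComplex.HomComplex.Cochain.comp_add _ _ _ _ }
  comm' i j _ := by
    ext z
    exact CochainComplex.HomComplex.δ_ofHom_comp f z j

/-- `I` is homotopically injective: `Hom_R(-, I)` preserves quasi-isomorphisms. -/
def IsHomotopicallyInjective {R : Type u} [CommRing R] (I : Cpx R) : Prop :=
  ∀ ⦃X Y : Cpx R⦄ (f : X ⟶ Y), QuasiIso f → QuasiIso (homPrecomp f I)

/-- `I` is semi-injective: it is homotopically injective and consists of injective modules. -/
structure IsSemiInjective {R : Type u} [CommRing R] (I : Cpx R) : Prop where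
  homotopicallyInjective : IsHomotopicallyInjective I
  injective : ∀ n : ℤ, Module.Injective R (I.X n)

/-- `I` is minimal: `Ker ∂ⁿ ⊆ Iⁿ` is an essential extension for each `n`. -/
def IsMinimal {R : Type u} [CommRing R] (I : Cpx R) : Prop :=
  ∀ n : ℤ, IsEssential (LinearMap.ker (I.d n (n + 1)).hom)

/-- `I` is contractible: its identity map is null-homotopic. -/
def IsContractible {R : Type u} [CommRing R] (I : Cpx R) : Prop :=
  Nonempty (Homotopy (𝟙 I) 0)

/-- The residue field `k(p) = R_p / p R_p`, as an `R`-module. -/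
abbrev residueField {R : Type u} [CommRing R] (p : PrimeSpectrum R) : ModuleCat.{u} R :=
  ModuleCat.of R p.asIdeal.ResidueField

/-- The derived tensor product `X ⊗ᴸ N` of a complex `X` with a module `N`: the tensor product
of `X` with a projective resolution of `N`. (A bounded above complex of projectives is
semi-projective, so this is the derived tensor product also when `X` is unbounded.) -/
def derivedTensor {R : Type u} [CommRing R] (X : Cpx R) (N : ModuleCat.{u} R) : Cpx R :=
  HomologicalComplex.tensorObj X (projectiveResolution N).cochainComplex

/-- The (small) support of a complex: the primes `p` with `H(X ⊗ᴸ k(p)) ≠ 0`. -/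
def supp {R : Type u} [CommRing R] (X : Cpx R) : Set (PrimeSpectrum R) :=
  {p | ¬ (derivedTensor X (residueField p)).Acyclic}

/-- The localization `X_p`, a complex of `R_p`-modules. -/
def localizeAt {R : Type u} [CommRing R] (X : Cpx R) (p : PrimeSpectrum R) :
    Cpx (Localization.AtPrime p.asIdeal) :=
  ((ModuleCat.localizedModuleFunctor p.asIdeal.primeCompl).mapHomologicalComplex _).obj X

/-! ### The complexes `J`, `I`, `X` -/

lemma mul_self_eq_zero {R : Type u} [CommRing R] {x : R}
    (hx : {r : R | r * x = 0} = (Ideal.span {x} : Set R)) : x * x = 0 := by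
  have h : x ∈ {r : R | r * x = 0} := by
    rw [hx]; exact Ideal.mem_span_singleton_self x
  exact h

section Construction

variable {R : Type u} [CommRing R] {x : R}
  (hx : {r : R | r * x = 0} = (Ideal.span {x} : Set R))
  (E : Type u) [AddCommGroup E] [Module R E]

/-- The complex `J : ⋯ → 0 → E → E → E → ⋯`, with the first `E` in degree `0` and each differential
between copies of `E` being multiplication by `x`. -/
def complexJ : Cpx R :=
  (CochainComplex.of (fun _ : ℕ => ModuleCat.of R E)
    (fun _ => ModuleCat.ofHom (LinearMap.lsmul R E x))
    (fun _ => by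
      ext e
      change x • x • e = 0
      rw [smul_smul, mul_self_eq_zero hx, zero_smul])).extend ComplexShape.embeddingUpNat

/-- The module `M = H⁰(J)`. -/
abbrev moduleM : ModuleCat.{u} R := (complexJ hx E).homology 0

/-- `M` viewed as a complex concentrated in degree `0`. -/
abbrev complexM : Cpx R := (HomologicalComplex.single (ModuleCat.{u} R) (.up ℤ) 0).obj (moduleM hx E)

lemma complexJ_d_to_zero : (complexJ hx E).d (-1) 0 = 0 :=
  (HomologicalComplex.isZero_extend_X _ ComplexShape.embeddingUpNat (-1)
    (fun n h => by change (n : ℤ) = -1 at h; omega)).eq_of_src _ _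

/-- The inclusion `ι : M ⟶ J`. As `J` vanishes in degree `-1`, the module `M = H⁰(J)` is
the module of cocycles `Ker (J⁰ ⟶ J¹)`, which is included in `J⁰`. -/
def iota : complexM hx E ⟶ complexJ hx E :=
  HomologicalComplex.mkHomFromSingle
    (((complexJ hx E).isoHomologyπ (-1) 0 (by simp) (complexJ_d_to_zero hx E)).inv ≫
      (complexJ hx E).iCycles 0)
    (fun k _ => by simp)

/-- `X = ∏_{i ∈ ℤ} Σⁱ M`. -/
def complexX : Cpx R := ∏ᶜ fun i : ℤ => (complexM hx E)⟦i⟧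

/-- `I = ∏_{i ∈ ℤ} Σⁱ J`. -/
def complexI : Cpx R := ∏ᶜ fun i : ℤ => (complexJ hx E)⟦i⟧

/-- The natural map `∏ Σⁱ ι : X ⟶ I`. -/
def naturalMap : complexX hx E ⟶ complexI hx E := Limits.Pi.map fun i : ℤ => (iota hx E)⟦i⟧'

end Construction

end SupportInjRes

end

/-!
Everything rests on how scalars act on `E = E(R/n)`: elements outside `n` act bijectively, elements
of `n` act locally nilpotently, and, because `ann x = (x)` and `E` is injective, the kernel of `x`
on `E` is its image. Products of complexes of modules are computed degreewise on elements, so these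
properties carry over from `E` to `J`, `I` and `X`.

* The complex `J` is a bounded below complex of injectives, hence K-injective, and products of
  K-injective complexes are K-injective. The kernels of the differentials of `I` are the kernels of
  `x`, which are essential because `x ^ 2 = 0`. The inclusion of `M` in `J` is a quasi-isomorphism
  as `J` is exact in positive degrees, and products of quasi-isomorphisms are quasi-isomorphisms.

* Each `I^k` is a product of infinitely many copies of `E`. As `n` is not a minimal prime, there is
  `t ∈ n` no power of which kills `E`, so `I^k` has an element that is not `t`-power torsion. An
  annihilator that is maximal among those of the multiples that are not `t`-power torsion is an
  associated prime avoiding `t` (`singleton_ssubset_ass_complexI`).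

* If `p ∈ Ass I^k` differs from `n`, then `p ⊊ n`, and so `X_p = 0`, because each element of `X` is
  killed by a power of any element of `n`. Hence `I_p` is acyclic. It is nonzero, and the kernels of
  its differentials are the kernels of `x`, where `x ^ 2 = 0`; such a complex is not contractible
  (`not_isContractible_localizeAt_complexI`), whereas an acyclic homotopically injective complex is.

* For `p ≠ n`, some scalar acts invertibly on one of `X` and `k(p)` and (locally) nilpotently on the
  other, which makes `X ⊗ᴸ k(p)` acyclic (`supp_complexX_subset`). Conversely, suppose
  `X ⊗ᴸ k(n)` is acyclic. The differential of `X` is zero and `X⁰` is isomorphic to `M`, so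
  `Tor(M, k(n)) = 0`. Dually, `Ext(k(n), M^*) = 0` for the character module `M^*` of `M`. By
  noetherian induction, `Ext(R_n/I, M^*) = 0` for all ideals `I` of the local ring `R_n`
  (`subsingleton_ext_quotient`): for a non-maximal prime `I` and `s ∈ n` outside `I`, multiplication
  by `s` is surjective on this group, which is the dual of the `s`-power torsion module
  `Tor(M, R_n/I)`. In particular `M^* = Hom(R_n, M^*) = 0`, so `M = 0`, which contradicts
  `1 ∈ R/n ⊆ E` being killed by `x`. Working with `Ext` gives access to long exact sequences.
-/

noncomputable section

namespace SupportInjRes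

/-! ### Multiplication on the injective hull of a prime quotient -/

section Algebra

variable {R : Type u} [CommRing R]

/-- If no power of `t` kills `y`, then some multiple of `y` has a prime annihilator
avoiding `t`. -/
lemma exists_isPrime_annihilator_of_pow_smul_ne_zero [IsNoetherianRing R] {M : Type u}
    [AddCommGroup M] [Module R M] (t : R) (y : M) (hy : ∀ k : ℕ, t ^ k • y ≠ 0) :
    ∃ (a : R) (p : Ideal R), p.IsPrime ∧ t ∉ p ∧ ∀ r : R, r ∈ p ↔ r • a • y = 0 := by
  let S : Set (Ideal R) :=
    {I | ∃ a : R, (∀ k : ℕ, t ^ k • a • y ≠ 0) ∧ I = Ideal.torsionOf R M (a • y)}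
  have hS : S.Nonempty := ⟨_, 1, by simpa using hy, rfl⟩
  obtain ⟨I, ⟨a, ha, rfl⟩, hmax⟩ := set_has_maximal_iff_noetherian.2 inferInstance S hS
  -- by maximality, multiplying `a • y` by an element that keeps it non-`t`-torsion
  -- does not enlarge the annihilator
  have key : ∀ b : R, (∀ k : ℕ, t ^ k • (b * a) • y ≠ 0) →
      ∀ r : R, r • (b * a) • y = 0 → r • a • y = 0 := by
    intro b hb r hr
    by_contra hne
    refine hmax _ ⟨b * a, hb, rfl⟩ (lt_of_le_of_ne ?_ ?_)
    · intro c hc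
      rw [Ideal.mem_torsionOf_iff] at hc ⊢
      rw [mul_smul, smul_comm, hc, smul_zero]
    · intro h
      apply hne
      rw [← Ideal.mem_torsionOf_iff, h, Ideal.mem_torsionOf_iff]
      exact hr
  have keyt : ∀ (k : ℕ) (r : R), r • t ^ k • a • y = 0 → r • a • y = 0 := by
    intro k r hr
    refine key (t ^ k) (fun l => ?_) r (by rwa [mul_smul])
    rw [mul_smul, smul_smul, ← pow_add]
    exact ha _
  refine ⟨a, Ideal.torsionOf R M (a • y), ⟨?_, ?_⟩, ?_, fun r => Ideal.mem_torsionOf_iff _ r⟩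
  · rw [Ideal.ne_top_iff_one, Ideal.mem_torsionOf_iff]
    simpa using ha 0
  · intro b c hbc
    rw [Ideal.mem_torsionOf_iff] at hbc
    rw [Ideal.mem_torsionOf_iff, Ideal.mem_torsionOf_iff, or_iff_not_imp_right]
    intro hc
    refine key c (fun k hk => hc (keyt k c ?_)) b (by rwa [mul_smul, smul_smul])
    rwa [smul_comm, ← mul_smul c]
  · rw [Ideal.mem_torsionOf_iff]
    simpa using ha 1

lemma mem_ass_iff [IsNoetherianRing R] {M : Type u} [AddCommGroup M] [Module R M]
    {p : PrimeSpectrum R} : p ∈ ass R M ↔ ∃ m : M, ∀ r : R, r ∈ p.asIdeal ↔ r • m = 0 := by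
  change IsAssociatedPrime p.asIdeal M ↔ _
  rw [isAssociatedPrime_iff]
  simp only [p.2, true_and]
  refine exists_congr fun m => ?_
  rw [Ideal.ext_iff]
  simp [Submodule.mem_colon_singleton]

/-- The kernel of `s` on the injective hull of `M` meets `M` in the kernel of `s` on `M`, so it is
zero if the latter is. -/
lemma eq_zero_of_smul_eq_zero_of_isInjectiveHull {M E : Type u} [AddCommGroup M] [Module R M]
    [AddCommGroup E] [Module R E] {j : M →ₗ[R] E} (hj : IsInjectiveHull j) {s : R}
    (hs : ∀ m : M, s • m = 0 → m = 0) {e : E} (he : s • e = 0) : e = 0 := by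
  by_contra hne
  refine hj.essential_range (LinearMap.ker (LinearMap.lsmul R E s)) ?_ ?_
  · intro h
    exact hne ((Submodule.mem_bot R).1
      (h ▸ (show e ∈ LinearMap.ker (LinearMap.lsmul R E s) from he)))
  · rw [eq_bot_iff]
    rintro _ ⟨⟨m, rfl⟩, hm⟩
    have hm' : j (s • m) = j 0 := by
      rw [map_smul, map_zero]; exact hm
    rw [hs m (hj.injective_map hm'), map_zero]
    exact Submodule.zero_mem _

/-- A relation-respecting choice of value extends: if `s • b = 0` for each `s` with `s * r = 0`,
then `b` is divisible by `r` in an injective module. -/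
lemma exists_smul_eq_of_injective {E : Type u} [AddCommGroup E] [Module R E]
    (hE : Module.Injective R E) (r : R) (b : E) (hb : ∀ s : R, s * r = 0 → s • b = 0) :
    ∃ e : E, r • e = b := by
  have hker : LinearMap.ker (LinearMap.toSpanSingleton R R r) ≤
      LinearMap.ker (LinearMap.toSpanSingleton R E b) := by
    intro s hs
    exact hb s hs
  let f : R ⧸ LinearMap.ker (LinearMap.toSpanSingleton R R r) →ₗ[R] R :=
    Submodule.liftQ _ (LinearMap.toSpanSingleton R R r) le_rfl
  have hf : Function.Injective f := by
    rw [← LinearMap.ker_eq_bot]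
    exact Submodule.ker_liftQ_eq_bot _ _ _ le_rfl
  obtain ⟨h, hh⟩ := hE.out f hf (Submodule.liftQ _ (LinearMap.toSpanSingleton R E b) hker)
  refine ⟨h 1, ?_⟩
  have := hh (Submodule.Quotient.mk 1)
  simp only [f, Submodule.liftQ_apply, LinearMap.toSpanSingleton_apply, one_smul] at this
  rw [← this, ← map_smul, smul_eq_mul, mul_one]

section Hull

variable {n : PrimeSpectrum R} {E : Type u} [AddCommGroup E] [Module R E]
  {j : (R ⧸ n.asIdeal) →ₗ[R] E} (hj : IsInjectiveHull j)
include hj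

lemma eq_zero_of_smul_eq_zero_of_notMem {s : R} (hs : s ∉ n.asIdeal) {e : E} (he : s • e = 0) :
    e = 0 := by
  refine eq_zero_of_smul_eq_zero_of_isInjectiveHull hj (fun m hm => ?_) he
  obtain ⟨r, rfl⟩ := Ideal.Quotient.mk_surjective m
  rw [Algebra.smul_def, Ideal.Quotient.algebraMap_eq, ← map_mul,
    Ideal.Quotient.eq_zero_iff_mem] at hm
  rw [Ideal.Quotient.eq_zero_iff_mem]
  exact (n.2.mem_or_mem hm).resolve_left hs

lemma exists_smul_eq_of_notMem {s : R} (hs : s ∉ n.asIdeal) (e : E) : ∃ e' : E, s • e' = e := by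
  refine exists_smul_eq_of_injective hj.injective_module s e (fun r hr => ?_)
  refine eq_zero_of_smul_eq_zero_of_notMem hj hs ?_
  rw [smul_smul, mul_comm, hr, zero_smul]

lemma bijective_smul_of_notMem {s : R} (hs : s ∉ n.asIdeal) :
    Function.Bijective fun e : E => s • e :=
  ⟨fun a b hab => sub_eq_zero.1 (eq_zero_of_smul_eq_zero_of_notMem hj hs
    (by rw [smul_sub]; exact sub_eq_zero.2 hab)), exists_smul_eq_of_notMem hj hs⟩

lemma smul_j_one_eq_zero_iff {r : R} : r • j 1 = 0 ↔ r ∈ n.asIdeal := by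
  rw [← map_smul, map_eq_zero_iff j hj.injective_map, Algebra.smul_def, mul_one,
    Ideal.Quotient.algebraMap_eq, Ideal.Quotient.eq_zero_iff_mem]

/-- Every element of `E(R/n)` is killed by a power of each element of `n`: otherwise a multiple
of it would have a prime annihilator different from `n`, contradicting essentiality. -/
lemma exists_pow_smul_eq_zero [IsNoetherianRing R] {s : R} (hs : s ∈ n.asIdeal) (e : E) :
    ∃ k : ℕ, s ^ k • e = 0 := by
  by_contra! h
  obtain ⟨a, p, hp, hsp, hap⟩ := exists_isPrime_annihilator_of_pow_smul_ne_zero s e h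
  have hne : a • e ≠ 0 := fun h0 =>
    hp.ne_top ((Ideal.eq_top_iff_one _).2 ((hap 1).2 (by simp [h0])))
  refine hj.essential_range (Submodule.span R {a • e}) (by simpa using hne) ?_
  rw [eq_bot_iff]
  rintro _ ⟨⟨m, rfl⟩, hm⟩
  obtain ⟨c, hc⟩ := Submodule.mem_span_singleton.1 hm
  obtain ⟨r, rfl⟩ := Ideal.Quotient.mk_surjective m
  have h1 : s • c • a • e = 0 := by
    rw [hc, ← map_smul, Algebra.smul_def, Ideal.Quotient.algebraMap_eq, ← map_mul,
      Ideal.Quotient.eq_zero_iff_mem.2 (n.asIdeal.mul_mem_right r hs), map_zero]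
  rw [smul_smul] at h1
  have h2 : c ∈ p := (hp.mem_or_mem ((hap _).2 h1)).resolve_left hsp
  rw [Submodule.mem_bot, ← hc, (hap c).1 h2]

/-- As `n` is not minimal, no power of some `t ∈ n` kills `E(R/n)`. -/
lemma exists_mem_forall_exists_pow_smul_ne_zero (hn : n.asIdeal ∉ minimalPrimes R) :
    ∃ t ∈ n.asIdeal, ∀ k : ℕ, ∃ e : E, t ^ k • e ≠ 0 := by
  obtain ⟨q, hq, hqn⟩ := Ideal.exists_minimalPrimes_le (I := ⊥) (J := n.asIdeal) bot_le
  have hqp : q.IsPrime := hq.1.1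
  have hne : ¬ n.asIdeal ≤ q := fun h => hn (le_antisymm hqn h ▸ hq)
  obtain ⟨t, htn, htq⟩ := Set.not_subset.1 hne
  refine ⟨t, htn, fun k => ?_⟩
  obtain ⟨e, he⟩ := exists_smul_eq_of_injective hj.injective_module (t ^ k) (j 1) (fun s hs => by
    rw [smul_j_one_eq_zero_iff hj]
    have : s * t ^ k ∈ q := hs ▸ q.zero_mem
    exact hqn ((hqp.mem_or_mem this).resolve_right (fun h => htq (hqp.mem_of_pow_mem _ h))))
  refine ⟨e, fun h => ?_⟩
  rw [he] at h
  have := (smul_j_one_eq_zero_iff hj (r := 1)).1 (by simpa using h)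
  exact n.2.ne_top ((Ideal.eq_top_iff_one _).2 this)

/-- Since `ann x = (x)` and `E` is injective, `E → E → E` (multiplication by `x`) is exact. -/
lemma exists_smul_eq_of_smul_eq_zero {x : R}
    (hx : {r : R | r * x = 0} = (Ideal.span {x} : Set R)) {e : E} (he : x • e = 0) :
    ∃ e' : E, x • e' = e := by
  refine exists_smul_eq_of_injective hj.injective_module x e (fun s hs => ?_)
  have : s ∈ (Ideal.span {x} : Set R) := hx ▸ hs
  obtain ⟨a, rfl⟩ := Ideal.mem_span_singleton'.1 this
  rw [mul_smul, he, smul_zero]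

end Hull

/-- If `ann x = (x)`, then `x` is nilpotent and so lies in every prime. -/
lemma mem_of_annihilator_eq {n : PrimeSpectrum R} {x : R}
    (hx : {r : R | r * x = 0} = (Ideal.span {x} : Set R)) : x ∈ n.asIdeal :=
  n.2.mem_of_pow_mem 2 (by rw [sq, mul_self_eq_zero hx]; exact n.asIdeal.zero_mem)

end Algebra

/-! ### Cohomology in terms of elements -/

section Elements

/-- Left homology data of a short complex of abelian groups, with the properties that determine the
homology in terms of elements. -/
lemma exists_leftHomologyData_ab (S : ShortComplex Ab.{u}) :
    ∃ h : S.LeftHomologyData,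
      (∀ z : S.X₂, S.g z = 0 → ∃ c : h.K, h.i c = z) ∧ Function.Surjective h.π ∧
      ∀ c : h.K, h.π c = 0 ↔ ∃ w : S.X₁, S.f w = h.i c := by
  have key (c : S.g.hom.ker) : (QuotientAddGroup.mk c : S.g.hom.ker ⧸ S.abToCycles.range) = 0 ↔
      ∃ w, S.abToCycles w = c := by
    rw [QuotientAddGroup.eq_zero_iff, AddMonoidHom.mem_range]
  exact ⟨S.abLeftHomologyData, fun z hz => ⟨⟨z, hz⟩, rfl⟩,
    Quotient.mk_surjective, fun c => (key c).trans (exists_congr fun w => Subtype.ext_iff)⟩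

/-- A morphism of short complexes of abelian groups is a quasi-isomorphism iff, on elements, it is
injective and surjective on cycles modulo boundaries. -/
lemma quasiIso_ab_iff {S₁ S₂ : ShortComplex Ab.{u}} (φ : S₁ ⟶ S₂) :
    ShortComplex.QuasiIso φ ↔
      (∀ z : S₁.X₂, S₁.g z = 0 → (∃ w : S₂.X₁, S₂.f w = φ.τ₂ z) → ∃ w : S₁.X₁, S₁.f w = z) ∧
      (∀ z : S₂.X₂, S₂.g z = 0 → ∃ y : S₁.X₂, S₁.g y = 0 ∧ ∃ w : S₂.X₁, S₂.f w = φ.τ₂ y - z) := by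
  obtain ⟨h₁, hl₁, hs₁, hπ₁⟩ := exists_leftHomologyData_ab S₁
  obtain ⟨h₂, hl₂, hs₂, hπ₂⟩ := exists_leftHomologyData_ab S₂
  let γ := ShortComplex.leftHomologyMapData φ h₁ h₂
  have h1 (c : h₁.K) : h₂.i (γ.φK c) = φ.τ₂ (h₁.i c) := by
    simpa only [ConcreteCategory.comp_apply] using ConcreteCategory.congr_hom γ.commi c
  have h2 (c : h₁.K) : γ.φH (h₁.π c) = h₂.π (γ.φK c) := by
    simpa only [ConcreteCategory.comp_apply] using ConcreteCategory.congr_hom γ.commπ c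
  have hg₁ (c : h₁.K) : S₁.g (h₁.i c) = 0 := by
    exact ConcreteCategory.congr_hom h₁.wi c
  have hg₂ (c : h₂.K) : S₂.g (h₂.i c) = 0 := by
    exact ConcreteCategory.congr_hom h₂.wi c
  rw [γ.quasiIso_iff, ConcreteCategory.isIso_iff_bijective]
  refine and_congr ⟨fun h z hz hw => ?_, fun h => ?_⟩ ⟨fun h z hz => ?_, fun h y => ?_⟩
  · obtain ⟨c, rfl⟩ := hl₁ z hz
    rw [← hπ₁]
    apply h
    rw [h2, map_zero, hπ₂, h1]
    exact hw
  · rw [injective_iff_map_eq_zero]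
    intro a ha
    obtain ⟨c, rfl⟩ := hs₁ a
    rw [h2, hπ₂, h1] at ha
    exact (hπ₁ c).2 (h _ (hg₁ c) ha)
  · obtain ⟨c, rfl⟩ := hl₂ z hz
    obtain ⟨a, ha⟩ := h (h₂.π c)
    obtain ⟨b, rfl⟩ := hs₁ a
    refine ⟨h₁.i b, hg₁ b, ?_⟩
    rw [← h1, ← map_sub, ← hπ₂, map_sub, ← h2, ha, sub_self]
  · obtain ⟨c, rfl⟩ := hs₂ y
    obtain ⟨z, hz, hw⟩ := h (h₂.i c) (hg₂ c)
    obtain ⟨b, rfl⟩ := hl₁ z hz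
    refine ⟨h₁.π b, ?_⟩
    rwa [← h1, ← map_sub, ← hπ₂, map_sub, ← h2, sub_eq_zero] at hw

lemma quasiIsoAt_ab_iff {K L : CochainComplex Ab.{u} ℤ} (f : K ⟶ L) (n : ℤ) :
    QuasiIsoAt f n ↔
      (∀ z : K.X n, K.d n (n + 1) z = 0 → (∃ w : L.X (n - 1), L.d (n - 1) n w = f.f n z) →
        ∃ w : K.X (n - 1), K.d (n - 1) n w = z) ∧
      (∀ z : L.X n, L.d n (n + 1) z = 0 →
        ∃ y : K.X n, K.d n (n + 1) y = 0 ∧ ∃ w : L.X (n - 1), L.d (n - 1) n w = f.f n y - z) := by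
  rw [quasiIsoAt_iff' f (n - 1) n (n + 1) (by simp) (by simp), quasiIso_ab_iff]
  rfl

variable {R : Type u} [CommRing R]

/-- Quasi-isomorphisms of complexes of modules, on elements. -/
lemma quasiIsoAt_iff_elements {K L : Cpx R} (f : K ⟶ L) (n : ℤ) :
    QuasiIsoAt f n ↔
      (∀ z : K.X n, K.d n (n + 1) z = 0 → (∃ w : L.X (n - 1), L.d (n - 1) n w = f.f n z) →
        ∃ w : K.X (n - 1), K.d (n - 1) n w = z) ∧
      (∀ z : L.X n, L.d n (n + 1) z = 0 →
        ∃ y : K.X n, K.d n (n + 1) y = 0 ∧ ∃ w : L.X (n - 1), L.d (n - 1) n w = f.f n y - z) := by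
  rw [← HomologicalComplex.quasiIsoAt_map_iff_of_preservesHomology f (forget₂ (ModuleCat.{u} R) Ab),
    quasiIsoAt_ab_iff]
  rfl

lemma exactAt_iff_elements (K : Cpx R) (n : ℤ) :
    K.ExactAt n ↔ ∀ z : K.X n, K.d n (n + 1) z = 0 → ∃ w : K.X (n - 1), K.d (n - 1) n w = z := by
  rw [K.exactAt_iff' (n - 1) n (n + 1) (by simp) (by simp), ShortComplex.moduleCat_exact_iff]
  rfl

/-! ### Products of complexes -/

variable (F : ℤ → Cpx R)

/-- The elements of degree `k` of a product of complexes are families of elements. -/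
lemma bijective_pi_f (k : ℤ) : Function.Bijective
    (fun (y : (∏ᶜ F : Cpx R).X k) (i : ℤ) => (Pi.π F i).f k y) := by
  let e₁ : ((∏ᶜ F : Cpx R).X k) ≅ ∏ᶜ fun i => (F i).X k :=
    PreservesProduct.iso (HomologicalComplex.eval (ModuleCat.{u} R) (.up ℤ) k) F
  have he₁ : ∀ i, e₁.hom ≫ Pi.π _ i = (Pi.π F i).f k := fun i =>
    piComparison_comp_π (HomologicalComplex.eval (ModuleCat.{u} R) (.up ℤ) k) F i
  let e : ((∏ᶜ F : Cpx R).X k) ≅ ModuleCat.of R (∀ i, (F i).X k) :=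
    e₁ ≪≫ ModuleCat.piIsoPi fun i => (F i).X k
  have he : ∀ (y : (∏ᶜ F : Cpx R).X k) (i : ℤ), e.hom y i = (Pi.π F i).f k y := by
    intro y i
    have : e.hom ≫ ModuleCat.ofHom (LinearMap.proj i) = (Pi.π F i).f k := by
      rw [Iso.trans_hom, Category.assoc, ← he₁]
      exact congrArg _ (ModuleCat.piIsoPi_hom_ker_subtype (fun i => (F i).X k) i)
    rw [← this]; rfl
  have h : (fun (y : (∏ᶜ F : Cpx R).X k) (i : ℤ) => (Pi.π F i).f k y) = e.hom := by
    ext y i; exact (he y i).symm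
  rw [h, ← ConcreteCategory.isIso_iff_bijective]
  infer_instance

/-- The linear equivalence between the degree `k` part of a product of complexes and the product
of the degree `k` parts. -/
def piEquiv (k : ℤ) : ((∏ᶜ F : Cpx R).X k) ≃ₗ[R] (∀ i, (F i).X k) :=
  LinearEquiv.ofBijective (LinearMap.pi fun i => ((Pi.π F i).f k).hom) (bijective_pi_f F k)

variable {F}

lemma piEquiv_d (k l : ℤ) (y : (∏ᶜ F : Cpx R).X k) (i : ℤ) :
    piEquiv F l ((∏ᶜ F : Cpx R).d k l y) i = (F i).d k l (piEquiv F k y i) :=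
  (ConcreteCategory.congr_hom ((Pi.π F i).comm k l) y).symm

lemma piEquiv_map {G : ℤ → Cpx R} (f : ∀ i, F i ⟶ G i) (k : ℤ) (y : (∏ᶜ F : Cpx R).X k) (i : ℤ) :
    piEquiv G k ((Limits.Pi.map f).f k y) i = (f i).f k (piEquiv F k y i) := by
  have : (Limits.Pi.map f).f k ≫ (Pi.π G i).f k = (Pi.π F i).f k ≫ (f i).f k := by
    rw [← HomologicalComplex.comp_f, Limits.Pi.map_π, HomologicalComplex.comp_f]
  exact ConcreteCategory.congr_hom this y

/-- In categories of modules, products of quasi-isomorphisms are quasi-isomorphisms. -/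
lemma quasiIso_piMap {G : ℤ → Cpx R} (f : ∀ i, F i ⟶ G i) (hf : ∀ i, QuasiIso (f i)) :
    QuasiIso (Limits.Pi.map f) := by
  rw [quasiIso_iff]
  intro n
  have hf' := fun i => (quasiIsoAt_iff_elements (f i) n).1 inferInstance
  rw [quasiIsoAt_iff_elements]
  constructor
  · rintro z hz ⟨w, hw⟩
    have : ∀ i, ∃ w : (F i).X (n - 1), (F i).d (n - 1) n w = piEquiv F n z i := fun i => by
      refine (hf' i).1 _ ?_ ⟨piEquiv G _ w i, ?_⟩
      · rw [← piEquiv_d, hz, map_zero]; rfl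
      · rw [← piEquiv_d, hw, piEquiv_map]
    choose v hv using this
    refine ⟨(piEquiv F _).symm v, (piEquiv F n).injective ?_⟩
    ext i
    rw [piEquiv_d, LinearEquiv.apply_symm_apply, hv]
  · intro z hz
    have : ∀ i, ∃ y : (F i).X n, (F i).d n (n + 1) y = 0 ∧ ∃ w : (G i).X (n - 1),
        (G i).d (n - 1) n w = (f i).f n y - piEquiv G n z i := fun i => by
      refine (hf' i).2 _ ?_
      rw [← piEquiv_d, hz, map_zero]; rfl
    choose y hy w hw using this
    refine ⟨(piEquiv F n).symm y, (piEquiv F _).injective ?_, (piEquiv G _).symm w,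
      (piEquiv G n).injective ?_⟩
    · ext i
      rw [piEquiv_d, LinearEquiv.apply_symm_apply, hy, map_zero]; rfl
    · ext i
      rw [piEquiv_d, LinearEquiv.apply_symm_apply, hw, map_sub, Pi.sub_apply, piEquiv_map,
        LinearEquiv.apply_symm_apply]

/-- Products of K-injective complexes are K-injective: null-homotopies can be chosen factorwise. -/
lemma isKInjective_pi (hF : ∀ i, CochainComplex.IsKInjective (F i)) :
    CochainComplex.IsKInjective (∏ᶜ F : Cpx R) where
  nonempty_homotopy_zero {K} f hK := by
    have h := fun i => ((hF i).nonempty_homotopy_zero (f ≫ Pi.π F i) hK).some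
    refine ⟨{
      hom := fun k l => ModuleCat.ofHom
        ((piEquiv F l).symm.toLinearMap ∘ₗ LinearMap.pi fun i => ((h i).hom k l).hom)
      zero := fun k l hkl => ?_
      comm := fun k => ?_ }⟩
    · ext y
      apply (piEquiv F l).injective
      ext i
      simp [(h i).zero k l hkl]
    · ext y
      apply (piEquiv F k).injective
      ext i
      have := ConcreteCategory.congr_hom ((h i).comm k) y
      rw [dNext_eq _ (show (ComplexShape.up ℤ).Rel k (k + 1) from rfl),
        prevD_eq _ (show (ComplexShape.up ℤ).Rel (k - 1) k by simp)] at this ⊢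
      simp only [HomologicalComplex.zero_f, add_zero] at this ⊢
      refine this.trans ?_
      rw [ModuleCat.hom_add, LinearMap.add_apply, map_add, Pi.add_apply]
      refine congrArg₂ (fun a b : (F i).X k => a + b) ?_ ?_
      · refine (congrFun ((piEquiv F k).apply_symm_apply
          (fun i => (h i).hom (k + 1) k (K.d k (k + 1) y))) i).symm
      · refine Eq.trans ?_ (piEquiv_d (k - 1) k _ i).symm
        refine congrArg ((F i).d (k - 1) k) ?_
        exact (congrFun ((piEquiv F (k - 1)).apply_symm_apply
          (fun i => (h i).hom k (k - 1) y)) i).symm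

end Elements

/-! ### Homotopically injective complexes -/

section HomotopicallyInjective

open CochainComplex.HomComplex

variable {R : Type u} [CommRing R]

/-- The cohomology of `Hom(Y, I)` is given by the groups of homotopy classes of maps `Y ⟶ I⟦n⟧`,
which are morphisms in the derived category if `I` is K-injective, and quasi-isomorphisms are
invertible there. -/
lemma isHomotopicallyInjective_of_isKInjective (I : Cpx R) [hI : CochainComplex.IsKInjective I] :
    IsHomotopicallyInjective I := by
  intro X Y f hf
  let Q := HomotopyCategory.quotient (ModuleCat.{u} R) (.up ℤ)
  have hbij : ∀ n : ℤ, Function.Bijective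
      (fun g : Q.obj Y ⟶ Q.obj (I⟦n⟧) => Q.map f ≫ g) := by
    intro n
    let := HasDerivedCategory.standard (ModuleCat.{u} R)
    have h1 := CochainComplex.IsKInjective.Qh_map_bijective (Q.obj Y) (I⟦n⟧)
    have h2 := CochainComplex.IsKInjective.Qh_map_bijective (Q.obj X) (I⟦n⟧)
    have : IsIso (DerivedCategory.Qh.map (Q.map f)) :=
      inferInstanceAs (IsIso (DerivedCategory.Q.map f))
    rw [← Function.Bijective.of_comp_iff' h2]
    have h3 : DerivedCategory.Qh.map ∘ (fun g : Q.obj Y ⟶ Q.obj (I⟦n⟧) => Q.map f ≫ g) =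
        (fun g => DerivedCategory.Qh.map (Q.map f) ≫ g) ∘ DerivedCategory.Qh.map := by
      ext g; simp
    rw [h3]
    exact ((Iso.homFromEquiv (asIso (DerivedCategory.Qh.map (Q.map f)))).symm.bijective).comp h1
  rw [quasiIso_iff]
  intro n
  have hQ : ∀ z : Cocycle Y I n, Q.map f ≫ CohomologyClass.toHom (.mk z) =
      CohomologyClass.toHom (.mk (Cocycle.precomp z f)) := by
    intro z
    rw [CohomologyClass.toHom_mk, CohomologyClass.toHom_mk, Cocycle.equivHomShift_symm_precomp,
      Functor.map_comp]
  rw [quasiIsoAt_ab_iff]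
  constructor
  · rintro z hz ⟨w, hw⟩
    let z' : Cocycle Y I n := Cocycle.mk z (n + 1) rfl hz
    have h1 : Cocycle.precomp z' f ∈ coboundaries X I n :=
      (mem_coboundaries_iff _ (n - 1) (by simp)).2 ⟨w, hw⟩
    rw [← CohomologyClass.toHom_mk_eq_zero_iff, ← hQ] at h1
    have h2 : CohomologyClass.toHom (.mk z') = 0 := (hbij n).1 (by simp [h1])
    rw [CohomologyClass.toHom_mk_eq_zero_iff, mem_coboundaries_iff _ (n - 1) (by simp)] at h2
    exact h2
  · intro z hz
    let z' : Cocycle X I n := Cocycle.mk z (n + 1) rfl hz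
    obtain ⟨g, hg⟩ := (hbij n).2 (CohomologyClass.toHom (.mk z'))
    obtain ⟨c, rfl⟩ := (CohomologyClass.toHom_bijective Y I n).2 g
    obtain ⟨y, rfl⟩ := c.mk_surjective
    have h1 : CohomologyClass.toHom (.mk (Cocycle.precomp y f - z')) = 0 := by
      rw [CohomologyClass.mk_sub, map_sub, ← hQ, sub_eq_zero]
      exact hg
    rw [CohomologyClass.toHom_mk_eq_zero_iff, mem_coboundaries_iff _ (n - 1) (by simp)] at h1
    exact ⟨y.1, y.δ_eq_zero (n + 1), h1⟩

/-- For acyclic `I`, the map `I ⟶ 0` is a quasi-isomorphism, so that `Hom(I, I)` is acyclic if `I`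
is homotopically injective; thus the cocycle `𝟙 I` is a coboundary. -/
lemma isContractible_of_acyclic_of_isHomotopicallyInjective {I : Cpx R}
    (hI : IsHomotopicallyInjective I) (h : I.Acyclic) : IsContractible I := by
  have h0 : QuasiIso (0 : I ⟶ (HomologicalComplex.zero : Cpx R)) := by
    rw [quasiIso_iff]
    intro n
    rw [quasiIsoAt_iff_exactAt _ _ (h n)]
    exact HomologicalComplex.ExactAt.of_isZero (isZero_zero _)
  have h1 := (quasiIso_iff _).1 (hI _ h0) 0
  rw [quasiIsoAt_ab_iff] at h1
  obtain ⟨y, w, hw⟩ : ∃ (y : Cochain HomologicalComplex.zero I 0) (w : Cochain I I (-1)),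
      δ (-1) 0 w = (Cochain.ofHom (0 : I ⟶ HomologicalComplex.zero)).comp y (zero_add 0) -
        Cochain.ofHom (𝟙 I) := by
    obtain ⟨y, -, w, hw⟩ := h1.2 (Cochain.ofHom (𝟙 I)) (δ_ofHom (p := 1) (𝟙 I))
    exact ⟨y, w, hw⟩
  rw [Cochain.ofHom_zero, Cochain.zero_comp, zero_sub] at hw
  refine ⟨(Cochain.equivHomotopy _ _).symm ⟨-w, ?_⟩⟩
  rw [δ_neg, hw, Cochain.ofHom_zero, neg_neg, add_zero]

end HomotopicallyInjective

/-! ### The complex `J` and the inclusion of `M` -/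

section ComplexJ

variable {R : Type u} [CommRing R] {x : R}
  (hx : {r : R | r * x = 0} = (Ideal.span {x} : Set R))
  (E : Type u) [AddCommGroup E] [Module R E]

/-- The complex `E → E → E → ⋯` indexed by `ℕ`, of which `J` is the extension by zero. -/
abbrev complexJNat : CochainComplex (ModuleCat.{u} R) ℕ :=
  CochainComplex.of (fun _ : ℕ => ModuleCat.of R E)
    (fun _ => ModuleCat.ofHom (LinearMap.lsmul R E x))
    (fun _ => by
      ext e
      change x • x • e = 0
      rw [smul_smul, mul_self_eq_zero hx, zero_smul])

/-- The identification of the degree `m` part of `J` with `E`, for `m ≥ 0`. -/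
def complexJEquiv (m : ℕ) (k : ℤ) (h : (m : ℤ) = k) : (complexJ hx E).X k ≃ₗ[R] E :=
  ((complexJNat hx E).extendXIso ComplexShape.embeddingUpNat (i := m) (i' := k) h).toLinearEquiv

lemma subsingleton_complexJ_X {k : ℤ} (hk : k < 0) : Subsingleton ((complexJ hx E).X k) :=
  ModuleCat.subsingleton_of_isZero (HomologicalComplex.isZero_extend_X _ _ k
    (fun m h => by change (m : ℤ) = k at h; omega))

lemma complexJEquiv_d (m : ℕ) (k : ℤ) (h : (m : ℤ) = k) (y : (complexJ hx E).X k) :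
    complexJEquiv hx E (m + 1) (k + 1) (by simp [h]) ((complexJ hx E).d k (k + 1) y) =
      x • complexJEquiv hx E m k h y := by
  have h1 : (complexJ hx E).d k (k + 1) = _ :=
    (complexJNat hx E).extend_d_eq ComplexShape.embeddingUpNat (i := m) (j := m + 1)
      (i' := k) (j' := k + 1) h (by change ((m + 1 : ℕ) : ℤ) = k + 1; simp [h])
  have h2 : (complexJNat hx E).d m (m + 1) = ModuleCat.ofHom (LinearMap.lsmul R E x) :=
    CochainComplex.of_d (fun _ : ℕ => ModuleCat.of R E)
      (fun _ => ModuleCat.ofHom (LinearMap.lsmul R E x)) m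
  refine (congrArg _ (ConcreteCategory.congr_hom h1 y)).trans ?_
  refine (LinearEquiv.apply_symm_apply (complexJEquiv hx E (m + 1) (k + 1) (by simp [h]))
    _).trans ?_
  exact ConcreteCategory.congr_hom h2 _

lemma complexJ_d_eq_zero_iff (k : ℤ) (y : (complexJ hx E).X k) :
    (complexJ hx E).d k (k + 1) y = 0 ↔ x • y = 0 := by
  by_cases hk : k < 0
  · have := subsingleton_complexJ_X hx E hk
    rw [Subsingleton.elim y 0]; simp
  · obtain ⟨m, rfl⟩ := Int.eq_ofNat_of_zero_le (not_lt.1 hk)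
    rw [← (complexJEquiv hx E m m rfl).map_eq_zero_iff (x := x • y), map_smul,
      ← complexJEquiv_d, LinearEquiv.map_eq_zero_iff]

/-- In positive degrees, `J` is exact because `ann x = (x)` and `E` is injective. -/
lemma complexJ_exact {n : PrimeSpectrum R} {j : (R ⧸ n.asIdeal) →ₗ[R] E}
    (hj : IsInjectiveHull j) (k : ℤ) (hk : 0 < k) : (complexJ hx E).ExactAt k := by
  obtain ⟨m, rfl⟩ : ∃ m : ℕ, k = (m : ℤ) + 1 := ⟨(k - 1).toNat, by omega⟩
  rw [exactAt_iff_elements]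
  intro z hz
  rw [complexJ_d_eq_zero_iff] at hz
  obtain ⟨e, he⟩ := exists_smul_eq_of_smul_eq_zero hj hx
    (e := complexJEquiv hx E (m + 1) _ (by simp) z) (by rw [← map_smul, hz, map_zero])
  have : ∃ w : (complexJ hx E).X (m : ℤ), (complexJ hx E).d m (m + 1) w = z := by
    refine ⟨(complexJEquiv hx E m m rfl).symm e, ?_⟩
    apply (complexJEquiv hx E (m + 1) (m + 1) (by simp)).injective
    rw [complexJEquiv_d hx E m m rfl, LinearEquiv.apply_symm_apply, he]
  rwa [add_sub_cancel_right]

lemma injective_complexJ_X (hE : Module.Injective R E) (k : ℤ) :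
    Injective ((complexJ hx E).X k) := by
  by_cases hk : k < 0
  · exact (ModuleCat.isZero_iff_subsingleton.2 (subsingleton_complexJ_X hx E hk)).injective
  · obtain ⟨m, rfl⟩ := Int.eq_ofNat_of_zero_le (not_lt.1 hk)
    have := (Module.injective_iff_injective_object R E).1 hE
    exact Injective.of_iso (complexJEquiv hx E m m rfl).symm.toModuleIso this

/-- `J` is a bounded below complex of injective modules. -/
lemma isKInjective_complexJ (hE : Module.Injective R E) :
    CochainComplex.IsKInjective (complexJ hx E) := by
  have := (Module.injective_iff_injective_object R E).1 hE
  have (m : ℕ) : Injective ((complexJNat hx E).X m) := this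
  exact inferInstanceAs
    (CochainComplex.IsKInjective ((complexJNat hx E).extend ComplexShape.embeddingUpNat))

lemma bijective_smul_complexJ_X {s : R} (hs : Function.Bijective fun e : E => s • e) (k : ℤ) :
    Function.Bijective fun y : (complexJ hx E).X k => s • y := by
  by_cases hk : k < 0
  · have := subsingleton_complexJ_X hx E hk
    exact ⟨fun _ _ _ => Subsingleton.elim _ _, fun y => ⟨y, Subsingleton.elim _ _⟩⟩
  · obtain ⟨m, rfl⟩ := Int.eq_ofNat_of_zero_le (not_lt.1 hk)
    let e := complexJEquiv hx E m m rfl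
    have : (fun y : (complexJ hx E).X m => s • y) = e.symm ∘ (fun y => s • y) ∘ e := by
      ext y; simp
    rw [this]
    exact e.symm.bijective.comp (hs.comp e.bijective)

lemma iota_f_zero : (iota hx E).f 0 = (HomologicalComplex.singleObjXSelf (.up ℤ) 0 _).hom ≫
    ((complexJ hx E).isoHomologyπ (-1) 0 (by simp) (complexJ_d_to_zero hx E)).inv ≫
      (complexJ hx E).iCycles 0 :=
  HomologicalComplex.mkHomFromSingle_f _ _

lemma subsingleton_complexM_X {k : ℤ} (hk : k ≠ 0) : Subsingleton ((complexM hx E).X k) :=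
  ModuleCat.subsingleton_of_isZero (HomologicalComplex.isZero_single_obj_X _ _ _ _ hk)

lemma injective_iota_f_zero : Function.Injective ((iota hx E).f 0) := by
  rw [← ModuleCat.mono_iff_injective, iota_f_zero]
  infer_instance

lemma exists_iota_f_zero_eq_iff (y : (complexJ hx E).X 0) :
    (∃ m, (iota hx E).f 0 m = y) ↔ x • y = 0 := by
  rw [← complexJ_d_eq_zero_iff]
  constructor
  · rintro ⟨m, rfl⟩
    have : (iota hx E).f 0 ≫ (complexJ hx E).d 0 (0 + 1) = 0 := by
      rw [iota_f_zero]; simp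
    exact ConcreteCategory.congr_hom this m
  · intro hy
    let K := complexJ hx E
    let f : ModuleCat.of R R ⟶ K.X 0 := ModuleCat.ofHom (LinearMap.toSpanSingleton R _ y)
    have hf : f ≫ K.d 0 (0 + 1) = 0 := by
      ext
      change K.d 0 (0 + 1) ((1 : R) • y) = 0
      rw [one_smul, hy]
    let g := K.liftCycles f (0 + 1) (by simp) hf
    have h : (g ≫ K.homologyπ 0 ≫ (HomologicalComplex.singleObjXSelf (.up ℤ) 0 _).inv) ≫
        (iota hx E).f 0 = f := by
      simp [iota_f_zero, g, K]
    refine ⟨_, (ConcreteCategory.congr_hom h (1 : R)).trans ?_⟩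
    exact one_smul R y

/-- `ι : M ⟶ J` is a quasi-isomorphism, as `J` is exact in positive degrees. -/
lemma quasiIso_iota {n : PrimeSpectrum R} {j : (R ⧸ n.asIdeal) →ₗ[R] E}
    (hj : IsInjectiveHull j) : QuasiIso (iota hx E) := by
  rw [quasiIso_iff]
  intro k
  rw [quasiIsoAt_iff_elements]
  rcases lt_trichotomy k 0 with hk | rfl | hk
  · have := subsingleton_complexJ_X hx E hk
    have := subsingleton_complexM_X hx E hk.ne
    exact ⟨fun z _ _ => ⟨0, Subsingleton.elim _ _⟩,
      fun z _ => ⟨0, by simp, 0, Subsingleton.elim _ _⟩⟩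
  · have := subsingleton_complexJ_X hx E (show (0 : ℤ) - 1 < 0 by simp)
    have := subsingleton_complexM_X hx E (show (0 : ℤ) + 1 ≠ 0 by simp)
    constructor
    · rintro z _ ⟨w, hw⟩
      refine ⟨0, injective_iota_f_zero hx E ?_⟩
      rw [← hw, Subsingleton.elim w 0]; simp
    · intro z hz
      rw [complexJ_d_eq_zero_iff, ← exists_iota_f_zero_eq_iff] at hz
      obtain ⟨m, rfl⟩ := hz
      exact ⟨m, Subsingleton.elim _ _, 0, by simp⟩
  · have := subsingleton_complexM_X hx E hk.ne'
    refine ⟨fun z _ _ => ⟨0, Subsingleton.elim _ _⟩, fun z hz => ⟨0, by simp, ?_⟩⟩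
    obtain ⟨w, hw⟩ := (exactAt_iff_elements _ _).1 (complexJ_exact hx E hj k hk) z hz
    exact ⟨-w, by simp [hw]⟩

/-! ### The complex `I` -/

/-- The degree `k` part of `I` is the product of the modules `J^{k+i}`. -/
def complexIEquiv (k : ℤ) : (complexI hx E).X k ≃ₗ[R] ∀ i : ℤ, (complexJ hx E).X (k + i) :=
  piEquiv (fun i : ℤ => (complexJ hx E)⟦i⟧) k

/-- The degree `k` part of `X` is the product of the degree `k + i` parts of `M`, only one of
which is nonzero. -/
def complexXEquiv (k : ℤ) : (complexX hx E).X k ≃ₗ[R] ∀ i : ℤ, (complexM hx E).X (k + i) :=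
  piEquiv (fun i : ℤ => (complexM hx E)⟦i⟧) k

/-- Up to signs, the differential of `I` is multiplication by `x`. -/
lemma complexI_d_eq_zero_iff (k : ℤ) (y : (complexI hx E).X k) :
    (complexI hx E).d k (k + 1) y = 0 ↔ x • y = 0 := by
  rw [← (complexIEquiv hx E (k + 1)).map_eq_zero_iff,
    ← (complexIEquiv hx E k).map_eq_zero_iff (x := x • y), funext_iff, funext_iff]
  refine forall_congr' fun i => ?_
  have h1 : complexIEquiv hx E (k + 1) ((complexI hx E).d k (k + 1) y) i =
      ((complexJ hx E)⟦i⟧).d k (k + 1) (complexIEquiv hx E k y i) := piEquiv_d _ _ _ _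
  rw [h1, map_smul, Pi.smul_apply, Pi.zero_apply, Pi.zero_apply]
  have key : ∀ (l : ℤ) (_ : k + i + 1 = l) (z : (complexJ hx E).X (k + i)),
      (i.negOnePow • (complexJ hx E).d (k + i) l) z = 0 ↔ x • z = 0 := by
    rintro _ rfl z
    rw [← complexJ_d_eq_zero_iff]
    rcases Int.even_or_odd i with hi | hi
    · rw [Int.negOnePow_even _ hi, one_smul]
    · rw [Int.negOnePow_odd _ hi, Units.neg_smul, one_smul]
      exact neg_eq_zero
  exact key (k + 1 + i) (by ring) _

lemma bijective_smul_complexI_X {s : R} (hs : Function.Bijective fun e : E => s • e) (k : ℤ) :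
    Function.Bijective fun y : (complexI hx E).X k => s • y := by
  have h : Function.Bijective fun y : (∀ i : ℤ, (complexJ hx E).X (k + i)) => s • y :=
    Function.Bijective.piMap fun i => bijective_smul_complexJ_X hx E hs (k + i)
  have : (fun y : (complexI hx E).X k => s • y) =
      (complexIEquiv hx E k).symm ∘ (fun y => s • y) ∘ complexIEquiv hx E k := by
    ext y; simp
  rw [this]
  exact (complexIEquiv hx E k).symm.bijective.comp (h.comp (complexIEquiv hx E k).bijective)

/-- `I` is minimal: the kernel of `x` is essential, as it contains `x • y` for each `y`. -/
lemma isMinimal_complexI : IsMinimal (complexI hx E) := by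
  intro k L hL h
  obtain ⟨y, hy, hy0⟩ := L.exists_mem_ne_zero_of_ne_bot hL
  rw [eq_bot_iff] at h
  by_cases hxy : x • y = 0
  · exact hy0 (h ⟨(complexI_d_eq_zero_iff hx E k y).2 hxy, hy⟩)
  · refine hxy (h ⟨(complexI_d_eq_zero_iff hx E k _).2 ?_, L.smul_mem x hy⟩)
    rw [smul_smul, mul_self_eq_zero hx, zero_smul]

lemma injective_complexI_X (hE : Module.Injective R E) (k : ℤ) :
    Module.Injective R ((complexI hx E).X k) := by
  have h (i : ℤ) : Module.Injective R ((complexJ hx E).X (k + i)) :=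
    (Module.injective_iff_injective_object R _).2 (injective_complexJ_X hx E hE _)
  have h' : Module.Injective R (∀ i : ℤ, (complexJ hx E).X (k + i)) := inferInstance
  rw [← Module.Baer.iff_injective] at h' ⊢
  exact h'.of_equiv (complexIEquiv hx E k).symm

lemma isSemiInjective_complexI (hE : Module.Injective R E) : IsSemiInjective (complexI hx E) where
  homotopicallyInjective := by
    have : CochainComplex.IsKInjective (complexI hx E) := isKInjective_pi fun i =>
      (CochainComplex.isKInjective_shift_iff _ i).2 (isKInjective_complexJ hx E hE)
    exact isHomotopicallyInjective_of_isKInjective _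
  injective := injective_complexI_X hx E hE

lemma quasiIso_naturalMap {n : PrimeSpectrum R} {j : (R ⧸ n.asIdeal) →ₗ[R] E}
    (hj : IsInjectiveHull j) : QuasiIso (naturalMap hx E) :=
  quasiIso_piMap _ fun i => by
    have := quasiIso_iota hx E hj
    infer_instance

/-- As `I^k` is a product of infinitely many copies of `E`, a family in `E` indexed by `ℕ` gives an
element of `I^k` with the same annihilator. -/
lemma exists_complexI_X_smul_eq_zero_iff (k : ℤ) (e : ℕ → E) :
    ∃ y : (complexI hx E).X k, ∀ r : R, r • y = 0 ↔ ∀ m, r • e m = 0 := by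
  classical
  refine ⟨(complexIEquiv hx E k).symm fun i =>
    if h : 0 ≤ k + i then (complexJEquiv hx E (k + i).toNat (k + i) (by omega)).symm
      (e (k + i).toNat) else 0, fun r => ?_⟩
  rw [← map_smul, LinearEquiv.map_eq_zero_iff, funext_iff]
  constructor
  · intro h m
    have := h (m - k)
    have hm : (k + (m - k)).toNat = m := by omega
    rw [Pi.smul_apply, dif_pos (by omega), ← map_smul, Pi.zero_apply, LinearEquiv.map_eq_zero_iff,
      hm] at this
    exact this
  · intro h i
    rw [Pi.smul_apply, Pi.zero_apply]
    split_ifs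
    · rw [← map_smul, h, map_zero]
    · rw [smul_zero]

/-- A family of elements of `E`, none of which is killed by the corresponding power of `t ∈ n`,
assembles to an element of `I^k` which is not `t`-power torsion; it has a multiple whose annihilator
is a prime not containing `t`. -/
lemma singleton_ssubset_ass_complexI [IsNoetherianRing R] {n : PrimeSpectrum R}
    (hn : n.asIdeal ∉ minimalPrimes R) {j : (R ⧸ n.asIdeal) →ₗ[R] E}
    (hj : IsInjectiveHull j) (k : ℤ) : {n} ⊂ ass R ((complexI hx E).X k) := by
  rw [Set.ssubset_iff_of_subset]
  · obtain ⟨t, ht, hte⟩ := exists_mem_forall_exists_pow_smul_ne_zero hj hn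
    choose e he using hte
    obtain ⟨y, hy⟩ := exists_complexI_X_smul_eq_zero_iff hx E k e
    obtain ⟨a, p, hp, htp, hap⟩ := exists_isPrime_annihilator_of_pow_smul_ne_zero t y
      (fun l h => he l ((hy _).1 h l))
    refine ⟨⟨p, hp⟩, mem_ass_iff.2 ⟨a • y, hap⟩, ?_⟩
    rintro rfl
    exact htp ht
  · rw [Set.singleton_subset_iff, mem_ass_iff]
    obtain ⟨y, hy⟩ := exists_complexI_X_smul_eq_zero_iff hx E k (fun _ => j 1)
    exact ⟨y, fun r => by rw [hy, forall_const, smul_j_one_eq_zero_iff hj]⟩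

/-! ### The complex `X` -/

lemma exists_pow_smul_eq_zero_complexM_X [IsNoetherianRing R] {n : PrimeSpectrum R}
    {j : (R ⧸ n.asIdeal) →ₗ[R] E} (hj : IsInjectiveHull j) {s : R} (hs : s ∈ n.asIdeal)
    (k : ℤ) (y : (complexM hx E).X k) : ∃ l : ℕ, s ^ l • y = 0 := by
  by_cases hk : k = 0
  · subst hk
    obtain ⟨l, hl⟩ := exists_pow_smul_eq_zero hj hs (complexJEquiv hx E 0 0 rfl ((iota hx E).f 0 y))
    refine ⟨l, injective_iota_f_zero hx E ?_⟩
    rw [← map_smul, ← map_smul, LinearEquiv.map_eq_zero_iff] at hl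
    rw [hl, map_zero]
  · have := subsingleton_complexM_X hx E hk
    exact ⟨0, Subsingleton.elim _ _⟩

lemma bijective_smul_complexM_X {s : R} (hs : Function.Bijective fun e : E => s • e) (k : ℤ) :
    Function.Bijective fun y : (complexM hx E).X k => s • y := by
  by_cases hk : k = 0
  · subst hk
    have hJ := bijective_smul_complexJ_X hx E hs 0
    constructor
    · intro y y' h
      refine injective_iota_f_zero hx E (hJ.1 ?_)
      change s • _ = s • _
      rw [← map_smul, ← map_smul]
      exact congrArg _ h
    · intro y
      obtain ⟨z, hz⟩ := hJ.2 ((iota hx E).f 0 y)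
      change s • z = _ at hz
      obtain ⟨y', rfl⟩ := (exists_iota_f_zero_eq_iff hx E z).2 (hJ.1 (by
        change s • x • z = s • 0
        rw [smul_comm, hz, smul_zero, (exists_iota_f_zero_eq_iff hx E _).1 ⟨y, rfl⟩]))
      refine ⟨y', injective_iota_f_zero hx E ?_⟩
      rw [← hz]
      exact map_smul _ _ _
  · have := subsingleton_complexM_X hx E hk
    exact ⟨fun _ _ _ => Subsingleton.elim _ _, fun y => ⟨y, Subsingleton.elim _ _⟩⟩

lemma exists_pow_smul_eq_zero_complexX_X [IsNoetherianRing R] {n : PrimeSpectrum R}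
    {j : (R ⧸ n.asIdeal) →ₗ[R] E} (hj : IsInjectiveHull j) {s : R} (hs : s ∈ n.asIdeal)
    (k : ℤ) (y : (complexX hx E).X k) : ∃ l : ℕ, s ^ l • y = 0 := by
  obtain ⟨l, hl⟩ := exists_pow_smul_eq_zero_complexM_X hx E hj hs _ (complexXEquiv hx E k y (-k))
  refine ⟨l, (complexXEquiv hx E k).map_eq_zero_iff.1 ?_⟩
  ext i
  by_cases hi : i = -k
  · subst hi
    rw [map_smul]
    exact hl
  · have := subsingleton_complexM_X hx E (show k + i ≠ 0 by omega)
    exact Subsingleton.elim _ _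

lemma bijective_smul_complexX_X {s : R} (hs : Function.Bijective fun e : E => s • e) (k : ℤ) :
    Function.Bijective fun y : (complexX hx E).X k => s • y := by
  have h : Function.Bijective fun y : (∀ i : ℤ, (complexM hx E).X (k + i)) => s • y :=
    Function.Bijective.piMap fun i => bijective_smul_complexM_X hx E hs (k + i)
  have : (fun y : (complexX hx E).X k => s • y) =
      (complexXEquiv hx E k).symm ∘ (fun y => s • y) ∘ complexXEquiv hx E k := by
    ext y; simp
  rw [this]
  exact (complexXEquiv hx E k).symm.bijective.comp (h.comp (complexXEquiv hx E k).bijective)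

end ComplexJ

/-! ### Localizations of `I` -/

section Localization

variable {R : Type u} [CommRing R] {x : R}
  (hx : {r : R | r * x = 0} = (Ideal.span {x} : Set R))
  (E : Type u) [AddCommGroup E] [Module R E] (p : PrimeSpectrum R)

/-- The localization map `Y → Y_p` in degree `k`. -/
def localizeMk (Y : Cpx R) (k : ℤ) : Y.X k →ₗ[R] ((Y.X k).localizedModule p.asIdeal.primeCompl) :=
  (Y.X k).localizedModuleMkLinearMap p.asIdeal.primeCompl

instance (Y : Cpx R) (k : ℤ) :
    IsLocalizedModule p.asIdeal.primeCompl (localizeMk p Y k) :=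
  ModuleCat.localizedModule_isLocalizedModule _ _

lemma localizeAt_d_mk (Y : Cpx R) (k l : ℤ) (y : Y.X k) :
    (localizeAt Y p).d k l (localizeMk p Y k y) = localizeMk p Y l (Y.d k l y) :=
  IsLocalizedModule.map_apply p.asIdeal.primeCompl (localizeMk p Y k) (localizeMk p Y l)
    (Y.d k l).hom y

lemma injective_localizeAt [IsNoetherianRing R] (Y : Cpx R) (k : ℤ)
    (hY : Module.Injective R (Y.X k)) :
    Module.Injective (Localization.AtPrime p.asIdeal) ((localizeAt Y p).X k) := by
  have : Module.Injective (Localization.AtPrime p.asIdeal)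
      ((Y.X k).localizedModule p.asIdeal.primeCompl) :=
    Module.injective_of_isLocalizedModule p.asIdeal.primeCompl (localizeMk p Y k)
  exact this

/-- Localization is exact, so a complex quasi-isomorphic to one that vanishes at `p` becomes acyclic
at `p`. -/
lemma acyclic_localizeAt_of_quasiIso {X Y : Cpx R} (f : X ⟶ Y) (hf : QuasiIso f)
    (hX : ∀ (k : ℤ) (m : X.X k), ∃ s : R, s ∉ p.asIdeal ∧ s • m = 0) :
    (localizeAt Y p).Acyclic := by
  intro k
  let F := ModuleCat.localizedModuleFunctor.{u} p.asIdeal.primeCompl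
  have h1 : QuasiIso ((F.mapHomologicalComplex (.up ℤ)).map f) := inferInstance
  refine (exactAt_iff_of_quasiIsoAt ((F.mapHomologicalComplex (.up ℤ)).map f) k).1 ?_
  apply HomologicalComplex.ExactAt.of_isZero
  rw [ModuleCat.isZero_iff_subsingleton]
  change Subsingleton ((X.X k).localizedModule p.asIdeal.primeCompl)
  refine ⟨fun a b => ?_⟩
  suffices h : ∀ z : (X.X k).localizedModule p.asIdeal.primeCompl, z = 0 by rw [h a, h b]
  intro z
  obtain ⟨⟨m, s⟩, rfl⟩ := IsLocalizedModule.mk'_surjective p.asIdeal.primeCompl (localizeMk p X k) z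
  obtain ⟨t, ht, htm⟩ := hX k m
  rw [Function.uncurry_apply_pair, IsLocalizedModule.mk'_eq_zero',
    Subtype.exists]
  exact ⟨t, ht, htm⟩

lemma localizeAt_complexI_d_eq_zero_iff (k l : ℤ) (hkl : k + 1 = l)
    (z : (localizeAt (complexI hx E) p).X k) :
    (localizeAt (complexI hx E) p).d k l z = 0 ↔
      algebraMap R (Localization.AtPrime p.asIdeal) x • z = 0 := by
  subst hkl
  obtain ⟨⟨m, s⟩, hz⟩ := IsLocalizedModule.mk'_surjective p.asIdeal.primeCompl
    (localizeMk p (complexI hx E) k) z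
  -- it suffices to treat the numerator `m` of `z`
  have hs : IsUnit (algebraMap R (Localization.AtPrime p.asIdeal) s) :=
    IsLocalization.map_units _ s
  have hm : algebraMap R (Localization.AtPrime p.asIdeal) s • z = localizeMk p _ k m := by
    refine (IsScalarTower.algebraMap_smul (M := (((complexI hx E).X k).localizedModule
      p.asIdeal.primeCompl)) (Localization.AtPrime p.asIdeal) (s : R) z).trans ?_
    rw [← hz]
    exact IsLocalizedModule.mk'_cancel' (localizeMk p (complexI hx E) k) m s
  have hx' (c : (complexI hx E).X k) :
      algebraMap R (Localization.AtPrime p.asIdeal) x • localizeMk p _ k c =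
        localizeMk p _ k (x • c) := by
    rw [map_smul]
    exact IsScalarTower.algebraMap_smul (M := (((complexI hx E).X k).localizedModule
      p.asIdeal.primeCompl)) (Localization.AtPrime p.asIdeal) x _
  rw [← hs.smul_eq_zero, ← map_smul, ← hs.smul_eq_zero (x := _ • z), smul_comm, hm]
  refine Iff.trans (?_ : _ ↔ localizeMk p _ (k + 1) ((complexI hx E).d k (k + 1) m) = 0) ?_
  · rw [← localizeAt_d_mk]; rfl
  refine Iff.trans ?_ (?_ : localizeMk p _ k (x • m) = 0 ↔ _)
  · rw [IsLocalizedModule.eq_zero_iff p.asIdeal.primeCompl,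
      IsLocalizedModule.eq_zero_iff p.asIdeal.primeCompl]
    refine exists_congr fun c => ?_
    rw [Submonoid.smul_def, Submonoid.smul_def, smul_comm, ← complexI_d_eq_zero_iff, map_smul]
  · rw [← hx']; rfl

/-- The differential of `I_p` has the same kernel as `x`, and `x ^ 2 = 0`. A contraction would thus
show that `x` kills `I_p`; then the differential vanishes, and so does `I_p`. -/
lemma not_isContractible_localizeAt_complexI {k : ℤ}
    (hp : ∃ y : (complexI hx E).X k, ∀ r : R, r • y = 0 → r ∈ p.asIdeal) :
    ¬ IsContractible (localizeAt (complexI hx E) p) := by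
  rintro ⟨h⟩
  set L := localizeAt (complexI hx E) p with hL
  let x' := algebraMap R (Localization.AtPrime p.asIdeal) x
  have hd := localizeAt_complexI_d_eq_zero_iff hx E p
  have hxx : x' * x' = 0 := by rw [← map_mul, mul_self_eq_zero hx, map_zero]
  have hh (k : ℤ) (z : L.X k) :
      z = h.hom (k + 1) k (L.d k (k + 1) z) + L.d (k - 1) k (h.hom k (k - 1) z) := by
    have := ConcreteCategory.congr_hom (h.comm k) z
    rw [dNext_eq _ (show (ComplexShape.up ℤ).Rel k (k + 1) from rfl),
      prevD_eq _ (show (ComplexShape.up ℤ).Rel (k - 1) k by simp)] at this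
    simpa using this
  have h1 (k : ℤ) (z : L.X k) : x' • z = 0 := by
    rw [hh k (x' • z), (hd k (k + 1) rfl (x' • z)).2 (by rw [← mul_smul, hxx, zero_smul]),
      map_zero, zero_add, map_smul]
    exact (hd (k - 1) k (by ring) _).2 (by rw [← mul_smul, hxx, zero_smul])
  have h2 (k : ℤ) (z : L.X k) : z = 0 := by
    rw [hh k z, (hd k (k + 1) rfl z).2 (h1 k z), map_zero, zero_add]
    exact (hd (k - 1) k (by ring) _).2 (h1 _ _)
  obtain ⟨y, hy⟩ := hp
  obtain ⟨c, hc⟩ := (IsLocalizedModule.eq_zero_iff p.asIdeal.primeCompl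
    (localizeMk p (complexI hx E) k) (m := y)).1 (h2 k (localizeMk p (complexI hx E) k y))
  exact c.2 (hy c hc)

/-- The associated primes of `I^k` other than `n` are properly contained in `n`. -/
lemma exists_mem_notMem_of_mem_ass_complexI [IsNoetherianRing R] {n : PrimeSpectrum R}
    {j : (R ⧸ n.asIdeal) →ₗ[R] E} (hj : IsInjectiveHull j) {k : ℤ}
    (hp : p ∈ ass R ((complexI hx E).X k)) (hpn : p ≠ n) : ∃ s ∈ n.asIdeal, s ∉ p.asIdeal := by
  obtain ⟨y, hy⟩ := mem_ass_iff.1 hp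
  have hle : p.asIdeal ≤ n.asIdeal := by
    intro s hs
    by_contra hsn
    have := (bijective_smul_complexI_X hx E (bijective_smul_of_notMem hj hsn) k).1
      (a₁ := y) (a₂ := 0) (by simp [(hy s).1 hs])
    exact p.2.ne_top ((Ideal.eq_top_iff_one _).2 ((hy 1).2 (by simp [this])))
  by_contra! h
  exact hpn (PrimeSpectrum.ext (le_antisymm hle h))

end Localization

/-! ### Tensor products with a complex with zero differential -/

section Tensor

open HomologicalComplex MonoidalCategory

variable {R : Type u} [CommRing R] (X P : Cpx R)

/-- If `X` has zero differential, then the differential of `X ⊗ P` respects the summands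
`Xⁱ ⊗ P`. -/
lemma ιTensorObj_d_of_d_eq_zero (hX : ∀ i j, X.d i j = 0) (i k l : ℤ) (h : i + k = l) :
    ιTensorObj X P i k l h ≫ (HomologicalComplex.tensorObj X P).d l (l + 1) =
      i.negOnePow • (X.X i ◁ P.d k (k + 1)) ≫ ιTensorObj X P i (k + 1) (l + 1) (by omega) := by
  rw [mapBifunctor.d_eq, Preadditive.comp_add, mapBifunctor.ι_D₁, mapBifunctor.ι_D₂,
    mapBifunctor.d₁_eq' _ _ _ _ (show (ComplexShape.up ℤ).Rel i (i + 1) from rfl), hX,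
    mapBifunctor.d₂_eq _ _ _ _ _ (show (ComplexShape.up ℤ).Rel k (k + 1) from rfl) _
      (show i + (k + 1) = l + 1 by omega)]
  simp

/-- The projection of `X ⊗ P` in degree `k` to the summand `X⁰ ⊗ Pᵏ`. -/
def tensorProj (k : ℤ) : (HomologicalComplex.tensorObj X P).X k ⟶ X.X 0 ⊗ P.X k :=
  mapBifunctorDesc fun i l (h : i + l = k) =>
    if hi : i = 0 then eqToHom (by subst hi; obtain rfl : l = k := by omega
                                   rfl) else 0

lemma ιTensorObj_tensorProj (k : ℤ) (h : 0 + k = k) :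
    ιTensorObj X P 0 k k h ≫ tensorProj X P k = 𝟙 _ := by
  simp [tensorProj]

lemma ιTensorObj_tensorProj_of_ne (i l k : ℤ) (hi : i ≠ 0) (h : i + l = k) :
    ιTensorObj X P i l k h ≫ tensorProj X P k = 0 := by
  simp [tensorProj, hi]

lemma d_tensorProj_of_d_eq_zero (hX : ∀ i j, X.d i j = 0) (k : ℤ) :
    (HomologicalComplex.tensorObj X P).d k (k + 1) ≫ tensorProj X P (k + 1) =
      tensorProj X P k ≫ (X.X 0 ◁ P.d k (k + 1)) := by
  apply mapBifunctor.hom_ext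
  intro i l h
  change i + l = k at h
  rw [← Category.assoc, ← Category.assoc]
  by_cases hi : i = 0
  · subst hi
    obtain rfl : l = k := by omega
    rw [ιTensorObj_d_of_d_eq_zero X P hX 0 l l h, ιTensorObj_tensorProj, Int.negOnePow_zero,
      one_smul, Category.assoc, ιTensorObj_tensorProj, Category.comp_id]
    exact (Category.id_comp _).symm
  · rw [ιTensorObj_d_of_d_eq_zero X P hX i l k h, ιTensorObj_tensorProj_of_ne X P i l k hi h,
      Linear.units_smul_comp, Category.assoc, ιTensorObj_tensorProj_of_ne X P i _ _ hi, comp_zero,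
      smul_zero, zero_comp]

/-- If `X` has zero differential and `X ⊗ P` is acyclic, then so is its direct summand `X⁰ ⊗ P`. -/
lemma exists_whiskerLeft_d_eq (hX : ∀ i j, X.d i j = 0)
    (h : (HomologicalComplex.tensorObj X P).Acyclic) (k : ℤ)
    (z : (X.X 0 ⊗ P.X (k + 1) : ModuleCat.{u} R)) (hz : (X.X 0 ◁ P.d (k + 1) (k + 1 + 1)) z = 0) :
    ∃ w : (X.X 0 ⊗ P.X k : ModuleCat.{u} R), (X.X 0 ◁ P.d k (k + 1)) w = z := by
  have hk : 0 + (k + 1) = k + 1 := zero_add _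
  have hcyc : (HomologicalComplex.tensorObj X P).d (k + 1) (k + 1 + 1)
      (ιTensorObj X P 0 (k + 1) (k + 1) hk z) = 0 := by
    have := ConcreteCategory.congr_hom (ιTensorObj_d_of_d_eq_zero X P hX 0 (k + 1) (k + 1) hk) z
    rw [Int.negOnePow_zero, one_smul] at this
    refine this.trans ?_
    rw [ConcreteCategory.comp_apply, hz, map_zero]
  obtain ⟨w, hw⟩ : ∃ w, (HomologicalComplex.tensorObj X P).d k (k + 1) w =
      ιTensorObj X P 0 (k + 1) (k + 1) hk z := by
    have := (exactAt_iff_elements _ _).1 (h (k + 1)) _ hcyc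
    rwa [add_sub_cancel_right] at this
  refine ⟨tensorProj X P k w, ?_⟩
  have h1 := ConcreteCategory.congr_hom (d_tensorProj_of_d_eq_zero X P hX k) w
  rw [ConcreteCategory.comp_apply, ConcreteCategory.comp_apply, hw] at h1
  rw [← h1]
  exact ConcreteCategory.congr_hom (ιTensorObj_tensorProj X P (k + 1) hk) z

end Tensor

/-! ### Scalars acting invertibly or nilpotently on a tensor product -/

section HomotopyInvariance

open HomologicalComplex MonoidalCategory

variable {R : Type u} [CommRing R]

/-- The action of an endomorphism of `P` on `X ⊗ P`. -/
abbrev tensorMap (X : Cpx R) {P : Cpx R} (f : P ⟶ P) :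
    HomologicalComplex.tensorObj X P ⟶ HomologicalComplex.tensorObj X P :=
  HomologicalComplex.tensorHom (𝟙 X) f

lemma tensorMap_id (X P : Cpx R) : tensorMap X (𝟙 P) = 𝟙 _ := by
  ext k : 1
  apply mapBifunctor.hom_ext
  intro i l h
  simp

lemma tensorMap_zero (X P : Cpx R) : tensorMap X (0 : P ⟶ P) = 0 := by
  ext k : 1
  apply mapBifunctor.hom_ext
  intro i l h
  simp

lemma tensorMap_smul (X : Cpx R) {P : Cpx R} (s : R) (f : P ⟶ P) :
    tensorMap X (s • f) = s • tensorMap X f := by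
  ext k : 1
  apply mapBifunctor.hom_ext
  intro i l h
  simp

lemma exists_pow_smul_eq_zero_tensorObj (X P : Cpx R) (s : R)
    (hs : ∀ (k : ℤ) (y : X.X k), ∃ m : ℕ, s ^ m • y = 0) (k : ℤ)
    (z : (HomologicalComplex.tensorObj X P).X k) : ∃ m : ℕ, s ^ m • z = 0 := by
  let T := Submodule.torsion' R ((HomologicalComplex.tensorObj X P).X k) (Submonoid.powers s)
  -- the torsion submodule contains each summand, so the quotient by it vanishes
  have h : ModuleCat.ofHom T.mkQ = 0 := by
    apply mapBifunctor.hom_ext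
    intro i l hil
    apply ModuleCat.MonoidalCategory.tensor_ext
    intro y p
    obtain ⟨m, hm⟩ := hs i y
    refine (Submodule.Quotient.mk_eq_zero T).2 ?_
    rw [Submodule.mem_torsion'_iff]
    refine ⟨⟨s ^ m, m, rfl⟩, ?_⟩
    change s ^ m • (ιTensorObj X P i l k hil) (y ⊗ₜ[R] p) = 0
    rw [← map_smul, TensorProduct.smul_tmul', hm, TensorProduct.zero_tmul, map_zero]
  have hz : z ∈ T := (Submodule.Quotient.mk_eq_zero T).1 (ConcreteCategory.congr_hom h z)
  obtain ⟨⟨_, m, rfl⟩, hm⟩ := (Submodule.mem_torsion'_iff _ _).1 hz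
  exact ⟨m, hm⟩

lemma exists_smul_eq_id_of_bijective (X : Cpx R) (s : R)
    (hs : ∀ k : ℤ, Function.Bijective fun y : X.X k => s • y) : ∃ t : X ⟶ X, s • t = 𝟙 X := by
  have (k : ℤ) : IsIso ((s • 𝟙 X : X ⟶ X).f k) := by
    rw [ConcreteCategory.isIso_iff_bijective]
    exact hs k
  have := HomologicalComplex.Hom.isIso_of_components (s • 𝟙 X : X ⟶ X)
  refine ⟨inv (s • 𝟙 X), ?_⟩
  have h := IsIso.hom_inv_id (s • 𝟙 X : X ⟶ X)
  rwa [Linear.smul_comp, Category.id_comp] at h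

lemma exists_d_eq_sub_of_homotopy {K L : Cpx R} {f g : K ⟶ L} (h : Homotopy f g) (k : ℤ)
    (z : K.X k) (hz : K.d k (k + 1) z = 0) : ∃ w, L.d (k - 1) k w = f.f k z - g.f k z := by
  have := ConcreteCategory.congr_hom (h.comm k) z
  rw [dNext_eq _ (show (ComplexShape.up ℤ).Rel k (k + 1) from rfl),
    prevD_eq _ (show (ComplexShape.up ℤ).Rel (k - 1) k by simp)] at this
  refine ⟨h.hom k (k - 1) z, ?_⟩
  rw [this]
  simp [hz]

/-- If `s` acts invertibly on `X` but null-homotopically on `P`, then `X ⊗ P` is acyclic. -/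
lemma acyclic_tensorObj_of_bijective (X P : Cpx R) (s : R)
    (hs : ∀ k : ℤ, Function.Bijective fun y : X.X k => s • y)
    (hP : Homotopy (s • 𝟙 P) 0) : (HomologicalComplex.tensorObj X P).Acyclic := by
  intro k
  rw [exactAt_iff_elements]
  intro z hz
  obtain ⟨t, ht⟩ := exists_smul_eq_id_of_bijective X s hs
  let T := HomologicalComplex.tensorHom t (𝟙 P)
  have hT : s • T = 𝟙 _ := by
    rw [← tensorMap_id, tensorMap, ← ht]
    ext k : 1
    apply mapBifunctor.hom_ext
    intro i l h
    simp [T]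
  let H : Homotopy (tensorMap X (s • 𝟙 P)) (tensorMap X 0) :=
    mapBifunctorMapHomotopy₂ (𝟙 X) hP (curriedTensor _) _
  have hTz : (HomologicalComplex.tensorObj X P).d k (k + 1) (T.f k z) = 0 := by
    have := ConcreteCategory.congr_hom (T.comm k (k + 1)) z
    exact this.trans (by rw [ConcreteCategory.comp_apply, hz, map_zero])
  obtain ⟨w, hw⟩ := exists_d_eq_sub_of_homotopy H k (T.f k z) hTz
  refine ⟨w, hw.trans ?_⟩
  rw [tensorMap_zero, tensorMap_smul, tensorMap_id]
  have := ConcreteCategory.congr_hom (congrArg (fun φ => HomologicalComplex.Hom.f φ k) hT) z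
  refine Eq.trans ?_ this
  exact sub_zero _

/-- If `s` acts locally nilpotently on `X` but invertibly up to homotopy on `P`, then `X ⊗ P` is
acyclic. -/
lemma acyclic_tensorObj_of_nilpotent (X P : Cpx R) (s : R)
    (hs : ∀ (k : ℤ) (y : X.X k), ∃ m : ℕ, s ^ m • y = 0) (f : P ⟶ P)
    (hP : Homotopy (s • f) (𝟙 P)) : (HomologicalComplex.tensorObj X P).Acyclic := by
  intro k
  rw [exactAt_iff_elements]
  let H : Homotopy (tensorMap X (s • f)) (tensorMap X (𝟙 P)) :=
    mapBifunctorMapHomotopy₂ (𝟙 X) hP (curriedTensor _) _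
  let T := tensorMap X f
  -- modulo boundaries, a cycle `z` agrees with the cycle `s • T z`, which `s ^ m` kills if
  -- `s ^ (m + 1)` kills `z`
  suffices key : ∀ (m : ℕ) (z : (HomologicalComplex.tensorObj X P).X k),
      (HomologicalComplex.tensorObj X P).d k (k + 1) z = 0 → s ^ m • z = 0 →
      ∃ w, (HomologicalComplex.tensorObj X P).d (k - 1) k w = z by
    intro z hz
    obtain ⟨m, hm⟩ := exists_pow_smul_eq_zero_tensorObj X P s hs k z
    exact key m z hz hm
  intro m
  induction m with
  | zero => exact fun z _ hm => ⟨0, by rw [map_zero, ← hm, pow_zero, one_smul]⟩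
  | succ m ih =>
    intro z hz hm
    have hsz : (HomologicalComplex.tensorObj X P).d k (k + 1) (s • T.f k z) = 0 := by
      have := ConcreteCategory.congr_hom (T.comm k (k + 1)) z
      rw [map_smul]
      refine (congrArg (s • ·) (this.trans (by
        rw [ConcreteCategory.comp_apply, hz, map_zero]))).trans (smul_zero _)
    obtain ⟨w, hw⟩ := ih (s • T.f k z) hsz (by
      rw [smul_smul, ← pow_succ, ← map_smul, hm, map_zero])
    obtain ⟨w', hw'⟩ := exists_d_eq_sub_of_homotopy H k z hz
    refine ⟨w - w', ?_⟩
    rw [map_sub, hw, hw', tensorMap_id, tensorMap_smul]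
    exact sub_sub_cancel _ _

end HomotopyInvariance

/-! ### The support of `X` is contained in `{n}` -/

section SupportAway

variable {R : Type u} [CommRing R]

lemma extendMap_smul {K L : ChainComplex (ModuleCat.{u} R) ℕ} (f : K ⟶ L) (s : R) :
    HomologicalComplex.extendMap (s • f) ComplexShape.embeddingDownNat =
      s • HomologicalComplex.extendMap f ComplexShape.embeddingDownNat := by
  ext k : 1
  by_cases hk : ∃ m, ComplexShape.embeddingDownNat.f m = k
  · obtain ⟨m, hm⟩ := hk
    rw [HomologicalComplex.smul_f_apply, HomologicalComplex.extendMap_f _ _ hm,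
      HomologicalComplex.extendMap_f _ _ hm]
    simp
  · exact (HomologicalComplex.isZero_extend_X _ _ k (by simpa using hk)).eq_of_src _ _

lemma single₀_map_smul {N N' : ModuleCat.{u} R} (f : N ⟶ N') (s : R) :
    (ChainComplex.single₀ _).map (s • f) = s • (ChainComplex.single₀ _).map f := by
  refine HomologicalComplex.to_single_hom_ext ?_
  ext y
  simp
  rfl

variable {N : ModuleCat.{u} R} (Q : ProjectiveResolution N)

/-- A scalar that kills `N` is null-homotopic on projective resolutions of `N`. -/
lemma nonempty_homotopy_smul_id_zero (s : R) (hs : s • 𝟙 N = 0) :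
    Nonempty (Homotopy (s • 𝟙 Q.cochainComplex) 0) := by
  have h : (s • 𝟙 Q.complex) ≫ Q.π = 0 := by
    rw [Linear.smul_comp, Category.id_comp]
    have : s • Q.π = Q.π ≫ (ChainComplex.single₀ _).map (s • 𝟙 N) := by
      rw [single₀_map_smul, Linear.comp_smul, CategoryTheory.Functor.map_id, Category.comp_id]
    rw [this, hs, Functor.map_zero, comp_zero]
  have H := (ProjectiveResolution.liftHomotopyZero (s • 𝟙 Q.complex) h).extend
    ComplexShape.embeddingDownNat
  rw [extendMap_smul, HomologicalComplex.extendMap_id, HomologicalComplex.extendMap_zero] at H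
  exact ⟨H⟩

/-- A scalar that is invertible on `N` is invertible up to homotopy on projective resolutions
of `N`. -/
lemma exists_homotopy_smul_id (s : R) (t : N ⟶ N) (hs : s • t = 𝟙 N) :
    ∃ f : Q.cochainComplex ⟶ Q.cochainComplex, Nonempty (Homotopy (s • f) (𝟙 _)) := by
  let f := ProjectiveResolution.lift t Q Q
  refine ⟨HomologicalComplex.extendMap f ComplexShape.embeddingDownNat, ?_⟩
  have h : (s • f) ≫ Q.π = Q.π ≫ (ChainComplex.single₀ _).map (𝟙 N) := by
    rw [Linear.smul_comp, ProjectiveResolution.lift_commutes, ← hs, single₀_map_smul,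
      Linear.comp_smul]
  have H := (ProjectiveResolution.liftHomotopy (𝟙 N) (s • f) (𝟙 Q.complex) h (by simp)).extend
    ComplexShape.embeddingDownNat
  rw [extendMap_smul, HomologicalComplex.extendMap_id] at H
  exact ⟨H⟩

lemma smul_id_residueField_eq_zero (p : PrimeSpectrum R) {s : R} (hs : s ∈ p.asIdeal) :
    s • 𝟙 (residueField p) = 0 := by
  ext y
  change s • y = 0
  rw [Algebra.smul_def, (Ideal.algebraMap_residueField_eq_zero).2 hs, zero_mul]

lemma exists_smul_eq_id_residueField (p : PrimeSpectrum R) {s : R} (hs : s ∉ p.asIdeal) :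
    ∃ t : residueField p ⟶ residueField p, s • t = 𝟙 _ := by
  have h : algebraMap R p.asIdeal.ResidueField s ≠ 0 :=
    fun h => hs (Ideal.algebraMap_residueField_eq_zero.1 h)
  refine ⟨ModuleCat.ofHom (LinearMap.mulLeft R (algebraMap R p.asIdeal.ResidueField s)⁻¹), ?_⟩
  ext y
  change s • ((algebraMap R p.asIdeal.ResidueField s)⁻¹ * y) = y
  rw [Algebra.smul_def, mul_inv_cancel_left₀ h]

/-- The support of `X` is contained in `{n}`, as elements of `n` act locally nilpotently on `X` and
elements outside `n` act invertibly. -/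
lemma supp_complexX_subset [IsNoetherianRing R] {x : R}
    (hx : {r : R | r * x = 0} = (Ideal.span {x} : Set R))
    (E : Type u) [AddCommGroup E] [Module R E] {n : PrimeSpectrum R}
    {j : (R ⧸ n.asIdeal) →ₗ[R] E} (hj : IsInjectiveHull j) :
    supp (complexX hx E) ⊆ {n} := by
  intro p hp
  by_contra hpn
  apply hp
  by_cases hle : p.asIdeal ≤ n.asIdeal
  · obtain ⟨s, hs, hsp⟩ := Set.not_subset.1
      (fun h : n.asIdeal ≤ p.asIdeal => hpn (PrimeSpectrum.ext (le_antisymm hle h)))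
    obtain ⟨t, ht⟩ := exists_smul_eq_id_residueField p hsp
    obtain ⟨f, ⟨H⟩⟩ := exists_homotopy_smul_id (projectiveResolution (residueField p)) s t ht
    exact acyclic_tensorObj_of_nilpotent _ _ s
      (exists_pow_smul_eq_zero_complexX_X hx E hj hs) f H
  · obtain ⟨s, hs, hsn⟩ := Set.not_subset.1 hle
    obtain ⟨H⟩ := nonempty_homotopy_smul_id_zero (projectiveResolution (residueField p)) s
      (smul_id_residueField_eq_zero p hs)
    exact acyclic_tensorObj_of_bijective _ _ s
      (bijective_smul_complexX_X hx E (bijective_smul_of_notMem hj hsn)) H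

end SupportAway

/-! ### Extensions by character modules -/

section SupportAt

open CategoryTheory.Abelian MonoidalCategory

variable {R : Type u} [CommRing R] (M : Type u) [AddCommGroup M] [Module R M]

/-- Tensor-hom adjunction for characters: `Hom_R(A, M^*) ≅ (M ⊗ A)^*`. -/
def pairing (A : Type u) [AddCommGroup A] [Module R A] :
    (A →ₗ[R] CharacterModule M) ≃ₗ[R] CharacterModule (TensorProduct R M A) :=
  CharacterModule.homEquiv.trans (CharacterModule.congr (TensorProduct.comm R A M))

variable {M}

lemma pairing_tmul {A : Type u} [AddCommGroup A] [Module R A] (f : A →ₗ[R] CharacterModule M)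
    (m : M) (a : A) : pairing M A f (m ⊗ₜ[R] a) = f a m := rfl

lemma pairing_comp {A B : Type u} [AddCommGroup A] [Module R A] [AddCommGroup B] [Module R B]
    (f : B →ₗ[R] CharacterModule M) (g : A →ₗ[R] B) (z : TensorProduct R M A) :
    pairing M A (f ∘ₗ g) z = pairing M B f (g.lTensor M z) := by
  induction z with
  | zero => simp
  | tmul m a => rfl
  | add y z hy hz => rw [map_add, map_add, map_add, hy, hz]

/-- A character which vanishes on the kernel of a linear map factors through the map, as `ℚ/ℤ` is
injective. -/
lemma exists_character_comp_eq {A B : Type u} [AddCommGroup A] [Module R A] [AddCommGroup B]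
    [Module R B] (g : A →ₗ[R] B) (φ : CharacterModule A) (h : ∀ z, g z = 0 → φ z = 0) :
    ∃ ψ : CharacterModule B, ∀ z, ψ (g z) = φ z := by
  let i : (A ⧸ LinearMap.ker g) →ₗ[R] B := (LinearMap.ker g).liftQ g le_rfl
  have hi : Function.Injective i := LinearMap.ker_eq_bot.1 (Submodule.ker_liftQ_eq_bot _ _ _ le_rfl)
  obtain ⟨ψ, hψ⟩ := CharacterModule.dual_surjective_of_injective i hi
    (QuotientAddGroup.lift (LinearMap.ker g).toAddSubgroup φ h)
  exact ⟨ψ, fun z => DFunLike.congr_fun hψ (Submodule.Quotient.mk z)⟩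

variable {N : ModuleCat.{u} R} (Q : ProjectiveResolution N)

/-- The cycles of `M ⊗ Q` in degree `i`. -/
def IsTensorCycle (i : ℕ) (z : TensorProduct R M (Q.complex.X i)) : Prop :=
  ∀ p : ℕ, p + 1 = i → (Q.complex.d i p).hom.lTensor M z = 0

/-- An extension class of `N` by `M^*` vanishes if the corresponding character of `M ⊗ Q` vanishes
on cycles. -/
lemma extMk_eq_zero_of_pairing {i : ℕ} (f : Q.complex.X i ⟶ ModuleCat.of R (CharacterModule M))
    (hf : Q.complex.d (i + 1) i ≫ f = 0)
    (h : ∀ z, IsTensorCycle Q i z → pairing M _ f.hom z = 0) : Q.extMk f (i + 1) rfl hf = 0 := by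
  obtain _ | p := i
  · have : f = 0 := by
      ext y : 2
      refine DFunLike.ext _ _ fun m => ?_
      rw [← pairing_tmul (M := M) f.hom]
      exact h _ (fun p hp => by omega)
    subst this
    exact Q.extMk_zero _ _
  · rw [Q.extMk_eq_zero_iff _ _ _ _ p rfl]
    obtain ⟨ψ, hψ⟩ := exists_character_comp_eq ((Q.complex.d (p + 1) p).hom.lTensor M)
      (pairing M _ f.hom) (fun z hz => h z (fun q hq => by obtain rfl : q = p := by omega
                                                           exact hz))
    refine ⟨ModuleCat.ofHom ((pairing M _).symm ψ), ?_⟩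
    apply ModuleCat.hom_ext
    apply (pairing M _).injective
    refine DFunLike.ext _ _ fun z => ?_
    rw [ModuleCat.hom_comp, pairing_comp, ModuleCat.hom_ofHom, LinearEquiv.apply_symm_apply, hψ]

/-- If `M ⊗ Q` is exact, then all `Ext`-groups from `N` to `M^*` vanish. -/
lemma subsingleton_ext_of_exact
    (h : ∀ i z, IsTensorCycle (M := M) Q i z →
      ∃ w, (Q.complex.d (i + 1) i).hom.lTensor M w = z) (i : ℕ) :
    Subsingleton (Ext N (ModuleCat.of R (CharacterModule M)) i) := by
  refine subsingleton_of_forall_eq 0 fun α => ?_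
  obtain ⟨f, hf, rfl⟩ := Q.extMk_surjective α (i + 1) rfl
  refine extMk_eq_zero_of_pairing Q f hf fun z hz => ?_
  obtain ⟨w, rfl⟩ := h i z hz
  rw [← pairing_comp, ← ModuleCat.hom_comp, hf, ModuleCat.hom_zero, map_zero]
  rfl

open CochainComplex.HomComplex in
/-- In degree `0` there are no coboundaries. -/
lemma eq_zero_of_extMk_eq_zero {D : ModuleCat.{u} R} (f : Q.complex.X 0 ⟶ D)
    (hf : Q.complex.d (0 + 1) 0 ≫ f = 0) (h : Q.extMk f (0 + 1) rfl hf = 0) : f = 0 := by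
  rw [← Q.extEquivCohomologyClass.apply_eq_iff_eq, Q.extEquivCohomologyClass_extMk,
    Q.extEquivCohomologyClass_zero, CohomologyClass.mk_eq_zero_iff,
    Cocycle.toSingleMk_mem_coboundaries_iff _ _ _ _ _ 1 (by simp)] at h
  obtain ⟨g, hg⟩ := h
  have hz : IsZero (Q.cochainComplex.X 1) :=
    CochainComplex.isZero_of_isStrictlyLE _ 0 1 (by simp)
  rw [hz.eq_of_src g 0, comp_zero] at hg
  rw [← cancel_epi (Q.cochainComplexXIso (-(0 : ℕ)) 0 rfl).hom, ← hg, comp_zero]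

lemma smul_extMk (s : R) {D : ModuleCat.{u} R} {i : ℕ} (f : Q.complex.X i ⟶ D)
    (hf : Q.complex.d (i + 1) i ≫ f = 0) :
    s • Q.extMk f (i + 1) rfl hf =
      Q.extMk (s • f) (i + 1) rfl (by rw [Linear.comp_smul, hf, smul_zero]) := by
  rw [Ext.smul_eq_comp_mk₀, Q.extMk_comp_mk₀]
  congr 1

lemma exists_pow_smul_eq_zero_tensorProduct {s : R} (hs : ∀ m : M, ∃ k : ℕ, s ^ k • m = 0)
    {A : Type u} [AddCommGroup A] [Module R A] (z : TensorProduct R M A) :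
    ∃ k : ℕ, s ^ k • z = 0 := by
  induction z with
  | zero => exact ⟨0, smul_zero _⟩
  | tmul m a =>
    obtain ⟨k, hk⟩ := hs m
    exact ⟨k, by rw [TensorProduct.smul_tmul', hk, TensorProduct.zero_tmul]⟩
  | add y z hy hz =>
    obtain ⟨k, hk⟩ := hy
    obtain ⟨l, hl⟩ := hz
    refine ⟨k + l, ?_⟩
    rw [smul_add, pow_add, mul_smul (s ^ k) (s ^ l) z, hl, mul_comm, mul_smul, hk, smul_zero,
      smul_zero, add_zero]

/-- If `s` is locally nilpotent on `M` but acts surjectively on `Ext^i(N, M^*)`, then this group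
vanishes: it is the dual of `Tor_i(M, N)`, on which `s` is then injective and locally nilpotent. -/
lemma subsingleton_ext_of_surjective {s : R} (hs : ∀ m : M, ∃ k : ℕ, s ^ k • m = 0) (i : ℕ)
    (h : Function.Surjective fun α : Ext N (ModuleCat.of R (CharacterModule M)) i => s • α) :
    Subsingleton (Ext N (ModuleCat.of R (CharacterModule M)) i) := by
  refine subsingleton_of_forall_eq 0 fun α => ?_
  have Q := projectiveResolution N
  have hk (k : ℕ) : ∃ β, s ^ k • β = α := by
    induction k with
    | zero => exact ⟨α, by rw [pow_zero, one_smul]⟩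
    | succ k ih =>
      obtain ⟨β, rfl⟩ := ih
      obtain ⟨γ, rfl⟩ := h β
      exact ⟨γ, by rw [pow_succ, mul_smul]⟩
  obtain ⟨f, hf, rfl⟩ := Q.extMk_surjective α (i + 1) rfl
  refine extMk_eq_zero_of_pairing Q f hf fun z hz => ?_
  obtain ⟨k, hkz⟩ := exists_pow_smul_eq_zero_tensorProduct hs z
  obtain ⟨β, hβ⟩ := hk k
  obtain ⟨g, hg, rfl⟩ := Q.extMk_surjective β (i + 1) rfl
  rw [smul_extMk, ← sub_eq_zero, Q.sub_extMk] at hβ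
  -- `s ^ k • g` and `f` differ by a coboundary, so the characters agree on cycles
  have h1 : pairing M _ (s ^ k • g - f).hom z = 0 := by
    obtain _ | p := i
    · have h0 := eq_zero_of_extMk_eq_zero Q _ _ hβ
      rw [h0, ModuleCat.hom_zero, map_zero]
      rfl
    · rw [Q.extMk_eq_zero_iff _ _ _ _ p rfl] at hβ
      obtain ⟨c, hc⟩ := hβ
      rw [← hc, ModuleCat.hom_comp, pairing_comp, hz p rfl, map_zero]
  have h2 : pairing M _ (s ^ k • g).hom z = 0 := by
    rw [ModuleCat.hom_smul, map_smul, CharacterModule.smul_apply, hkz, map_zero]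
  rw [ModuleCat.hom_sub, map_sub] at h1
  have h3 : pairing M _ (s ^ k • g).hom z - pairing M _ f.hom z = 0 := h1
  rwa [h2, zero_sub, neg_eq_zero] at h3


section ShortExact

variable {S : ShortComplex (ModuleCat.{u} R)} (hS : S.ShortExact) {D : ModuleCat.{u} R} {i : ℕ}

include hS

lemma subsingleton_ext_of_shortExact (h₁ : Subsingleton (Ext S.X₁ D i))
    (h₃ : Subsingleton (Ext S.X₃ D i)) : Subsingleton (Ext S.X₂ D i) := by
  refine subsingleton_of_forall_eq 0 fun α => ?_
  obtain ⟨β, rfl⟩ := Ext.contravariant_sequence_exact₂ hS D α (Subsingleton.elim _ _)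
  rw [Subsingleton.elim β 0, Ext.comp_zero]

/-- The long exact sequence for `0 → N → N → N' → 0`, the first map being multiplication by `s`. -/
lemma surjective_smul_ext_of_shortExact (h₃ : Subsingleton (Ext S.X₃ D (i + 1))) (e : S.X₁ ≅ S.X₂)
    (s : R) (hs : S.f = s • e.hom) : Function.Surjective fun α : Ext S.X₁ D i => s • α := by
  intro α
  obtain ⟨β, rfl⟩ := Ext.contravariant_sequence_exact₁ hS D α (add_comm 1 i) (Subsingleton.elim _ _)
  refine ⟨(Ext.mk₀ e.hom).comp β (zero_add i), ?_⟩
  rw [hs, Ext.mk₀_smul, Ext.smul_comp]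

end ShortExact

/-- For ideals with `K = (I : a)`, the short exact sequence
`0 → A/K → A/I → A/(I + (a)) → 0`, where the first map is multiplication by `a`. -/
lemma exists_shortExact_quotient {A : Type u} [CommRing A] [Algebra R A] (I K : Ideal A) (a : A)
    (hK : ∀ b, b ∈ K ↔ a * b ∈ I) :
    ∃ (f : ModuleCat.of R (A ⧸ K) ⟶ ModuleCat.of R (A ⧸ I))
      (g : ModuleCat.of R (A ⧸ I) ⟶ ModuleCat.of R (A ⧸ (I ⊔ Ideal.span {a}))) (w : f ≫ g = 0),
      (∀ b : A, f.hom (Ideal.Quotient.mk K b) = Ideal.Quotient.mk I (a * b)) ∧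
      (ShortComplex.mk f g w).ShortExact := by
  let φ : (A ⧸ K) →ₗ[A] (A ⧸ I) := Submodule.liftQ K
    (Submodule.mkQ I ∘ₗ LinearMap.mulLeft A a) (fun b hb => by
      rw [LinearMap.mem_ker]
      exact (Submodule.Quotient.mk_eq_zero _).2 ((hK b).1 hb))
  let ψ : (A ⧸ I) →ₗ[A] (A ⧸ (I ⊔ Ideal.span {a})) := Submodule.mapQ _ _ LinearMap.id le_sup_left
  have hφ (b : A) : φ (Ideal.Quotient.mk K b) = Ideal.Quotient.mk I (a * b) := rfl
  have hψ (b : A) : ψ (Ideal.Quotient.mk I b) = Ideal.Quotient.mk _ b := rfl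
  refine ⟨ModuleCat.ofHom (φ.restrictScalars R), ModuleCat.ofHom (ψ.restrictScalars R), ?_, hφ, ?_⟩
  · ext y
    obtain ⟨b, rfl⟩ := Ideal.Quotient.mk_surjective y
    change ψ (φ (Ideal.Quotient.mk K b)) = 0
    rw [hφ, hψ, Ideal.Quotient.eq_zero_iff_mem]
    exact Ideal.mul_mem_right _ _ (Ideal.mem_sup_right (Ideal.mem_span_singleton_self a))
  · refine @ShortComplex.ShortExact.mk _ _ _ _ ?_ ?_ ?_
    · rw [ShortComplex.moduleCat_exact_iff]
      intro y hy
      obtain ⟨b, rfl⟩ := Ideal.Quotient.mk_surjective y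
      change ψ (Ideal.Quotient.mk I b) = 0 at hy
      rw [hψ, Ideal.Quotient.eq_zero_iff_mem, Submodule.mem_sup] at hy
      obtain ⟨c, hc, d, hd, rfl⟩ := hy
      obtain ⟨e, rfl⟩ := Ideal.mem_span_singleton'.1 hd
      refine ⟨Ideal.Quotient.mk K e, (hφ e).trans ?_⟩
      rw [Ideal.Quotient.eq, mul_comm a e, sub_add_cancel_right]
      exact I.neg_mem hc
    · rw [ModuleCat.mono_iff_injective]
      change Function.Injective φ
      refine (injective_iff_map_eq_zero φ).2 fun y hy => ?_
      obtain ⟨b, rfl⟩ := Ideal.Quotient.mk_surjective y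
      rw [hφ, Ideal.Quotient.eq_zero_iff_mem, ← hK] at hy
      exact Ideal.Quotient.eq_zero_iff_mem.2 hy
    · rw [ModuleCat.epi_iff_surjective]
      intro y
      obtain ⟨b, rfl⟩ := Ideal.Quotient.mk_surjective y
      exact ⟨Ideal.Quotient.mk I b, hψ b⟩

/-- Let `A` be a noetherian local `R`-algebra such that every non-maximal prime misses an element of
`R` which is locally nilpotent on `M`. If the groups `Ext(k, M^*)` vanish for the residue field `k`
of `A`, then so do the groups `Ext(A/I, M^*)` for all ideals `I`, by noetherian induction. -/
lemma subsingleton_ext_quotient {A : Type u} [CommRing A] [IsLocalRing A] [IsNoetherianRing A]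
    [Algebra R A] (hM : ∀ I : Ideal A, I.IsPrime → I ≠ IsLocalRing.maximalIdeal A →
      ∃ s : R, algebraMap R A s ∉ I ∧ ∀ m : M, ∃ k : ℕ, s ^ k • m = 0)
    (hk : ∀ i, Subsingleton (Ext (ModuleCat.of R (A ⧸ IsLocalRing.maximalIdeal A))
      (ModuleCat.of R (CharacterModule M)) i)) (I : Ideal A) (i : ℕ) :
    Subsingleton (Ext (ModuleCat.of R (A ⧸ I)) (ModuleCat.of R (CharacterModule M)) i) := by
  induction I using WellFoundedGT.induction generalizing i with
  | ind I ih =>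
  by_cases hI : I.IsPrime
  · by_cases hmax : I = IsLocalRing.maximalIdeal A
    · rw [hmax]
      exact hk i
    obtain ⟨s, hsI, hs⟩ := hM I hI hmax
    obtain ⟨f, g, w, hf, hS⟩ := exists_shortExact_quotient (R := R) I I (algebraMap R A s)
      (fun b => ⟨fun h => I.mul_mem_left _ h, fun h => (hI.mem_or_mem h).resolve_left hsI⟩)
    refine subsingleton_ext_of_surjective hs i
      (surjective_smul_ext_of_shortExact hS (ih _ ?_ _) (Iso.refl _) s ?_)
    · exact lt_of_le_of_ne le_sup_left fun h => hsI
        (h ▸ Ideal.mem_sup_right (Ideal.mem_span_singleton_self _))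
    · ext y
      obtain ⟨b, rfl⟩ := Ideal.Quotient.mk_surjective y
      refine (hf b).trans ?_
      change _ = s • (Ideal.Quotient.mk I b)
      rw [Algebra.smul_def]
      rfl
  · by_cases htop : I = ⊤
    · have : Subsingleton (A ⧸ I) := Ideal.Quotient.subsingleton_iff.2 htop
      have hz : IsZero (ModuleCat.of R (A ⧸ I)) := ModuleCat.isZero_of_subsingleton _
      refine subsingleton_of_forall_eq 0 fun α => ?_
      rw [← Ext.mk₀_id_comp α, hz.eq_of_src (𝟙 _) 0, Ext.mk₀_zero, Ext.zero_comp]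
    obtain ⟨a, ha, b, hb, hab⟩ := (Ideal.not_isPrime_iff.1 hI).resolve_left htop
    obtain ⟨f, g, w, -, hS⟩ := exists_shortExact_quotient (R := R) I
      (Submodule.comap (LinearMap.mulLeft A a) I) a (fun b => Iff.rfl)
    refine subsingleton_ext_of_shortExact hS (ih _ ?_ _) (ih _ ?_ _)
    · exact lt_of_le_of_ne (fun c hc => I.mul_mem_left a hc) fun h => hb (h ▸ hab)
    · exact lt_of_le_of_ne le_sup_left fun h => ha
        (h ▸ Ideal.mem_sup_right (Ideal.mem_span_singleton_self a))

end SupportAt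

/-! ### The prime `n` belongs to the support of `X` -/

section SupportEq

open CategoryTheory.Abelian MonoidalCategory

variable {R : Type u} [CommRing R]

lemma subsingleton_of_subsingleton_characterModule {M : Type u} [AddCommGroup M]
    (h : Subsingleton (CharacterModule M)) : Subsingleton M :=
  subsingleton_of_forall_eq 0 fun _ => CharacterModule.eq_zero_of_character_apply
    fun c => by rw [Subsingleton.elim c 0]; rfl

/-- If the elements outside a prime `p` act invertibly on `D`, then `D = Hom_R(R_p, D)`. -/
lemma subsingleton_of_subsingleton_hom_localization {p : Ideal R} [p.IsPrime] {D : Type u}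
    [AddCommGroup D] [Module R D] (hD : ∀ s ∉ p, Function.Bijective fun d : D => s • d)
    (h : Subsingleton (Localization.AtPrime p →ₗ[R] D)) : Subsingleton D := by
  have hu (s : p.primeCompl) : IsUnit (algebraMap R (Module.End R D) s) :=
    (Module.End.isUnit_iff _).2 (hD s s.2)
  refine subsingleton_of_forall_eq 0 fun d => ?_
  have := IsLocalizedModule.lift_apply p.primeCompl (Algebra.linearMap R (Localization.AtPrime p))
    (LinearMap.toSpanSingleton R D d) hu 1
  rw [Subsingleton.elim (IsLocalizedModule.lift _ _ _ hu) 0, LinearMap.toSpanSingleton_apply,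
    one_smul] at this
  exact this.symm

/-- If `Ext(k(n), M^*) = 0` for a module `M` on which elements of `n` act locally nilpotently and
elements outside `n` act invertibly, then `M = 0`. -/
lemma subsingleton_of_subsingleton_ext_residueField [IsNoetherianRing R] (n : PrimeSpectrum R)
    {M : Type u} [AddCommGroup M] [Module R M]
    (hn : ∀ s ∈ n.asIdeal, ∀ m : M, ∃ k : ℕ, s ^ k • m = 0)
    (hu : ∀ s ∉ n.asIdeal, Function.Bijective fun m : M => s • m)
    (h : ∀ i, Subsingleton (Ext (residueField n) (ModuleCat.of R (CharacterModule M)) i)) :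
    Subsingleton M := by
  let A := Localization.AtPrime n.asIdeal
  have : IsNoetherianRing A := IsLocalization.isNoetherianRing n.asIdeal.primeCompl A inferInstance
  have key := subsingleton_ext_quotient (R := R) (A := A) (M := M) (fun I hI hmax => ?_) h ⊥ 0
  · apply subsingleton_of_subsingleton_characterModule
    refine subsingleton_of_subsingleton_hom_localization (p := n.asIdeal) (fun s hs => ?_) ?_
    · exact CharacterModule.dual_bijective_iff_bijective (f := LinearMap.lsmul R M s).2 (hu s hs)
    · have e : (A ⧸ (⊥ : Ideal A)) ≃ₗ[R] A :=
        (Submodule.quotEquivOfEqBot (⊥ : Ideal A) rfl).restrictScalars R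
      refine ⟨fun f g => ?_⟩
      have h1 : ModuleCat.ofHom (f ∘ₗ e.toLinearMap) = ModuleCat.ofHom (g ∘ₗ e.toLinearMap) :=
        (Ext.addEquiv₀ (X := ModuleCat.of R (A ⧸ (⊥ : Ideal A)))
          (Y := ModuleCat.of R (CharacterModule M))).symm.injective (Subsingleton.elim _ _)
      refine LinearMap.ext fun a => ?_
      obtain ⟨b, rfl⟩ := e.surjective a
      rw [← LinearEquiv.coe_coe, ← LinearMap.comp_apply, ← LinearMap.comp_apply]
      exact ConcreteCategory.congr_hom h1 b
  · by_contra! hc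
    refine hmax ((IsLocalRing.le_maximalIdeal hI.ne_top).antisymm ?_)
    rw [← Localization.AtPrime.map_eq_maximalIdeal, Ideal.map_le_iff_le_comap]
    intro s hs
    by_contra hsI
    obtain ⟨m, hm⟩ := hc s hsI
    obtain ⟨k, hk⟩ := hn s hs m
    exact hm k hk

/-- `X` is a product of complexes concentrated in one degree. -/
lemma complexX_d_eq_zero {x : R} (hx : {r : R | r * x = 0} = (Ideal.span {x} : Set R))
    (E : Type u) [AddCommGroup E] [Module R E] (k l : ℤ) : (complexX hx E).d k l = 0 := by
  ext y
  refine (complexXEquiv hx E l).injective (funext fun i => ?_)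
  refine (piEquiv_d k l y i).trans ?_
  rw [CochainComplex.shiftFunctor_obj_d', HomologicalComplex.single_obj_d, smul_zero]
  exact (congrFun (complexXEquiv hx E l).map_zero i).symm

/-- If `X` has zero differential and the tensor product of `X` with a projective resolution `Q` is
acyclic, then `X⁰ ⊗ Q` is exact. -/
lemma exists_lTensor_d_eq {X : Cpx R} (hX : ∀ i j, X.d i j = 0) {N : ModuleCat.{u} R}
    (Q : ProjectiveResolution N) (h : (HomologicalComplex.tensorObj X Q.cochainComplex).Acyclic)
    (i : ℕ) (z : TensorProduct R (X.X 0) (Q.complex.X i)) (hz : IsTensorCycle Q i z) :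
    ∃ w, (Q.complex.d (i + 1) i).hom.lTensor (X.X 0) w = z := by
  obtain ⟨k, hk⟩ : ∃ k : ℤ, -((i + 1 : ℕ) : ℤ) = k := ⟨_, rfl⟩
  have hk' : -((i : ℕ) : ℤ) = k + 1 := by push_cast at hk; omega
  let e := Q.cochainComplexXIso (k + 1) i hk'
  have hd : Q.cochainComplex.d k (k + 1) = (Q.cochainComplexXIso k (i + 1) hk).hom ≫
      Q.complex.d (i + 1) i ≫ e.inv := Q.cochainComplex_d _ _ _ _ hk hk'
  have hez : (X.X 0 ◁ Q.cochainComplex.d (k + 1) (k + 1 + 1)) ((X.X 0 ◁ e.inv) z) = 0 := by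
    obtain _ | p := i
    · have hz : IsZero (Q.cochainComplex.X (k + 1 + 1)) :=
        CochainComplex.isZero_of_isStrictlyLE _ 0 _ (by simp at hk'; omega)
      rw [hz.eq_of_tgt (Q.cochainComplex.d (k + 1) (k + 1 + 1)) 0,
        MonoidalPreadditive.whiskerLeft_zero]
      rfl
    · have hp : -(p : ℤ) = k + 1 + 1 := by push_cast at hk'; omega
      have hd' : Q.cochainComplex.d (k + 1) (k + 1 + 1) = e.hom ≫
        Q.complex.d (p + 1) p ≫ (Q.cochainComplexXIso (k + 1 + 1) p hp).inv :=
          Q.cochainComplex_d _ _ _ _ hk' hp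
      have h1 : X.X 0 ◁ e.inv ≫ X.X 0 ◁ Q.cochainComplex.d (k + 1) (k + 1 + 1) =
          X.X 0 ◁ Q.complex.d (p + 1) p ≫
            X.X 0 ◁ (Q.cochainComplexXIso (k + 1 + 1) p hp).inv := by
        rw [hd', ← whiskerLeft_comp, ← whiskerLeft_comp]; simp
      refine (ConcreteCategory.congr_hom h1 z).trans ?_
      refine (congrArg (X.X 0 ◁ (Q.cochainComplexXIso (k + 1 + 1) p hp).inv) (hz p rfl)).trans ?_
      exact map_zero (X.X 0 ◁ (Q.cochainComplexXIso (k + 1 + 1) p hp).inv).hom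
  obtain ⟨w, hw⟩ := exists_whiskerLeft_d_eq X Q.cochainComplex hX h k ((X.X 0 ◁ e.inv) z) hez
  refine ⟨(X.X 0 ◁ (Q.cochainComplexXIso k (i + 1) hk).hom) w, ?_⟩
  have h1 : X.X 0 ◁ Q.cochainComplex.d k (k + 1) ≫ X.X 0 ◁ e.hom =
      X.X 0 ◁ (Q.cochainComplexXIso k (i + 1) hk).hom ≫ X.X 0 ◁ Q.complex.d (i + 1) i := by
    rw [hd, ← whiskerLeft_comp, ← whiskerLeft_comp]; simp
  have h2 : X.X 0 ◁ e.inv ≫ X.X 0 ◁ e.hom = 𝟙 _ := by rw [← whiskerLeft_comp]; simp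
  refine (ConcreteCategory.congr_hom h1 w).symm.trans ?_
  refine (congrArg (X.X 0 ◁ e.hom) hw).trans ?_
  exact ConcreteCategory.congr_hom h2 z

variable {x : R} (hx : {r : R | r * x = 0} = (Ideal.span {x} : Set R))
    (E : Type u) [AddCommGroup E] [Module R E] {n : PrimeSpectrum R}
    {j : (R ⧸ n.asIdeal) →ₗ[R] E} (hj : IsInjectiveHull j)

include hj

/-- The image of `1` in `E` is a nonzero element of `M`, as `x ∈ n`. -/
lemma nontrivial_complexX_X_zero : Nontrivial ((complexX hx E).X 0) := by
  by_contra hc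
  rw [not_nontrivial_iff_subsingleton] at hc
  have hM : Subsingleton ((complexM hx E).X (0 + 0)) := by
    refine ⟨fun a b => ?_⟩
    have := (complexXEquiv hx E 0).symm.injective.subsingleton
    have h := congrFun (Subsingleton.elim (Pi.single (M := fun i => (complexM hx E).X (0 + i)) 0 a)
      (Pi.single (M := fun i => (complexM hx E).X (0 + i)) 0 b)) 0
    rwa [Pi.single_eq_same, Pi.single_eq_same] at h
  have : Subsingleton ((complexM hx E).X 0) := hM
  let e := complexJEquiv hx E 0 0 rfl
  obtain ⟨m, hm⟩ := (exists_iota_f_zero_eq_iff hx E (e.symm (j 1))).2 (by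
    rw [← map_smul, (smul_j_one_eq_zero_iff hj).2 (mem_of_annihilator_eq hx), map_zero])
  rw [Subsingleton.elim m 0, map_zero, eq_comm, LinearEquiv.map_eq_zero_iff,
    ← one_smul R (j 1), smul_j_one_eq_zero_iff hj] at hm
  exact n.2.ne_top ((Ideal.eq_top_iff_one _).2 hm)

/-- If `n` were not in the support, then `Tor(M, k(n)) = 0` and so `Ext(k(n), M^*) = 0`, which
forces `M = 0`. -/
lemma supp_complexX [IsNoetherianRing R] : supp (complexX hx E) = {n} := by
  refine (supp_complexX_subset hx E hj).antisymm ?_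
  intro p hp h
  rw [Set.mem_singleton_iff.1 hp] at h
  have := nontrivial_complexX_X_zero hx E hj
  refine not_subsingleton ((complexX hx E).X 0) ?_
  exact subsingleton_of_subsingleton_ext_residueField n
    (fun s hs => exists_pow_smul_eq_zero_complexX_X hx E hj hs 0)
    (fun s hs => bijective_smul_complexX_X hx E (bijective_smul_of_notMem hj hs) 0)
    (subsingleton_ext_of_exact (projectiveResolution (residueField n))
      (exists_lTensor_d_eq (complexX_d_eq_zero hx E) _ h))

end SupportEq

end SupportInjRes

end

open SupportInjRes in
theorem proposition2p6 {R : Type u} [CommRing R] [IsNoetherianRing R]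
    (n : PrimeSpectrum R) (hn : n.asIdeal ∉ minimalPrimes R)
    (x : R) (hx : {r : R | r * x = 0} = (Ideal.span {x} : Set R))
    (E : Type u) [AddCommGroup E] [Module R E]
    (j : (R ⧸ n.asIdeal) →ₗ[R] E) (hj : IsInjectiveHull j) :
    -- (1) `I` is semi-injective and minimal
    (IsSemiInjective (complexI hx E) ∧ IsMinimal (complexI hx E)) ∧
    -- (2) the natural map `X ⟶ I` is a quasi-isomorphism
    QuasiIso (naturalMap hx E) ∧
    -- (3) `supp X = {n} ⊊ Ass Iᵏ` for each integer `k`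
    (supp (complexX hx E) = {n} ∧ ∀ k : ℤ, {n} ⊂ ass R ((complexI hx E).X k)) ∧
    -- (4) the localizations `I_p` at primes `p ≠ n` in `Ass Iᵏ`
    (∀ (k : ℤ) (p : PrimeSpectrum R), p ∈ ass R ((complexI hx E).X k) → p ≠ n →
      (∀ i : ℤ, Module.Injective (Localization.AtPrime p.asIdeal)
        ((localizeAt (complexI hx E) p).X i)) ∧
      (localizeAt (complexI hx E) p).Acyclic ∧
      ¬ IsContractible (localizeAt (complexI hx E) p) ∧
      ¬ IsHomotopicallyInjective (localizeAt (complexI hx E) p)) := by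
  have hE := hj.injective_module
  refine ⟨⟨isSemiInjective_complexI hx E hE, isMinimal_complexI hx E⟩, quasiIso_naturalMap hx E hj,
    ⟨supp_complexX hx E hj, singleton_ssubset_ass_complexI hx E hn hj⟩, fun k p hp hpn => ?_⟩
  have hacyclic : (localizeAt (complexI hx E) p).Acyclic := by
    obtain ⟨s, hs, hsp⟩ := exists_mem_notMem_of_mem_ass_complexI hx E p hj hp hpn
    refine acyclic_localizeAt_of_quasiIso p (naturalMap hx E) (quasiIso_naturalMap hx E hj)
      fun i m => ?_
    obtain ⟨l, hl⟩ := exists_pow_smul_eq_zero_complexX_X hx E hj hs i m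
    exact ⟨s ^ l, fun h => hsp (p.2.mem_of_pow_mem l h), hl⟩
  have hcontr : ¬ IsContractible (localizeAt (complexI hx E) p) := by
    obtain ⟨y, hy⟩ := mem_ass_iff.1 hp
    exact not_isContractible_localizeAt_complexI hx E p ⟨y, fun r => (hy r).2⟩
  exact ⟨fun i => injective_localizeAt p _ i (injective_complexI_X hx E hE i), hacyclic, hcontr,
    fun h => hcontr (isContractible_of_acyclic_of_isHomotopicallyInjective h hacyclic)⟩
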